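/- Let $P$ be a finite set of points in the plane $\mathbb{R}^2$. It is in \emph{general position} if no three of its points are collinear, and in \emph{convex position} if no point of $P$ lies in the convex hull of the others. Sets $K_1,\dots,K_k\subset\mathbb{R}^2$ \emph{cover} $\mathbb{R}^2\setminus P$ if $\bigcup_i K_i=\mathbb{R}^2\setminus P$, and they \emph{encapsulate} $P$ if every $p\in P$ has a neighborhood $N$ with $\left(\bigcup_i K_i\right)\cap N=N\setminus\{p\}$. Let $\mathrm{cov}(P)$ (respectively $\mathrm{cov}_\circ(P)$) be the smallest number of convex sets (respectively pairwise disjoint convex sets) that cover $\mathbb{R}^2\setminus P$, and let $\mathrm{enc}(P)$ (respectively $\mathrm{enc}_\circ(P)$) be the smallest number of convex sets (respectively pairwise disjoint convex sets) that encapsulate $P$. For each of these parameters $f$ and each $n\in\mathbb{N}=\{0,1,2,\dots\}$, let $f(n)$ be the maximum of $f(P)$ over all $n$-point sets $P$ in general position, and $f^c(n)$ the maximum over all $n$-point sets $P$ in convex position. Put $\delta(n)=1$ for $n=0,1,3$ and $\delta(n)=0$ otherwise. Then for every $n\ge 0$ the following holds. 1. For every set $P$ of $n$ points in convex position, $$\mathrm{cov}(P)=\left\lfloor\tfrac{n+5}{2}\right\rfloor-\delta(n),\qquad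 \mathrm{cov}_\circ(P)=\left\lfloor\tfrac{2n+5}{3}\right\rfloor,$$ and, if $n\ge1$, also $\mathrm{enc}(P)=\left\lfloor\frac{n+5}{2}\right\rfloor-\delta(n)$ and $\mathrm{enc}_\circ(P)=\left\lfloor\frac{2n+5}{3}\right\rfloor$. Consequently $\mathrm{cov}^c(n)=\left\lfloor\frac{n+5}{2}\right\rfloor-\delta(n)$ and $\mathrm{cov}^c_\circ(n)=\left\lfloor\frac{2n+5}{3}\right\rfloor$, and, if $n\ge1$, also $\mathrm{enc}^c(n)=\left\lfloor\frac{n+5}{2}\right\rfloor-\delta(n)$ and $\mathrm{enc}^c_\circ(n)=\left\lfloor\frac{2n+5}{3}\right\rfloor$. 2. For every set $P$ of $n$ points in general position, $$\mathrm{enc}(P),\ \mathrm{cov}(P)\le\tfrac{7n}{11}+4,\qquad \mathrm{enc}_\circ(P),\ \mathrm{cov}_\circ(P)\le\left\lfloor\tfrac{2n+5}{3}\right\rfloor.$$ Consequently $\left\lfloor\frac{n+5}{2}\right\rfloor-\delta(n)\le\mathrm{cov}(n)\le\frac{7n}{11}+4$, $\mathrm{enc}(n)\le\frac{7n}{11}+4$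 and $\mathrm{cov}_\circ(n)=\left\lfloor\frac{2n+5}{3}\right\rfloor$, and, if $n\ge1$, also $\left\lfloor\frac{n+5}{2}\right\rfloor-\delta(n)\le\mathrm{enc}(n)$ and $\mathrm{enc}_\circ(n)=\left\lfloor\frac{2n+5}{3}\right\rfloor$. -/

import Mathlib

open scoped ENNReal Topology

/-- The Euclidean plane. -/
abbrev Plane : Type := EuclideanSpace ℝ (Fin 2)

/-- No three distinct points of `P` lie on a line. -/
def GeneralPosition (P : Finset Plane) : Prop :=
  ∀ a ∈ P, ∀ b ∈ P, ∀ c ∈ P, a ≠ b → a ≠ c → b ≠ c → ¬ Collinear ℝ ({a, b, c} : Set Plane)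

/-- No point of `P` lies in the convex hull of the other points of `P`. -/
def ConvexPosition (P : Finset Plane) : Prop :=
  ConvexIndependent ℝ ((↑) : P → Plane)

/-- The sets `K i` cover the complement of `P`, and are subsets of it. -/
def CoversCompl {k : ℕ} (K : Fin k → Set Plane) (P : Finset Plane) : Prop :=
  ⋃ i, K i = (P : Set Plane)ᶜ

/-- The union of the sets `K i` is, in some neighbourhood `N` of `p`, equal to `N` minus `p`. -/
def EncapsulatesPoint {k : ℕ} (K : Fin k → Set Plane) (p : Plane) : Prop :=
  ∃ N ∈ 𝓝 p, (⋃ i, K i) ∩ N = N \ {p}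

/-- The sets `K i` encapsulate every point of `P`. -/
def Encapsulates {k : ℕ} (K : Fin k → Set Plane) (P : Finset Plane) : Prop :=
  ∀ p ∈ P, EncapsulatesPoint K p

/-- The smallest number of convex sets that cover the complement of `P` (`⊤` if there is none). -/
noncomputable def cov (P : Finset Plane) : ℕ∞ :=
  ⨅ (k : ℕ) (_ : ∃ K : Fin k → Set Plane, (∀ i, Convex ℝ (K i)) ∧ CoversCompl K P), (k : ℕ∞)

/-- The smallest number of pairwise disjoint convex sets that cover the complement of `P`. -/
noncomputable def covDisj (P : Finset Plane) : ℕ∞ :=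
  ⨅ (k : ℕ) (_ : ∃ K : Fin k → Set Plane, (∀ i, Convex ℝ (K i)) ∧
    Pairwise (fun i j => Disjoint (K i) (K j)) ∧ CoversCompl K P), (k : ℕ∞)

/-- The smallest number of convex sets that encapsulate `P`. -/
noncomputable def enc (P : Finset Plane) : ℕ∞ :=
  ⨅ (k : ℕ) (_ : ∃ K : Fin k → Set Plane, (∀ i, Convex ℝ (K i)) ∧ Encapsulates K P), (k : ℕ∞)

/-- The smallest number of pairwise disjoint convex sets that encapsulate `P`. -/
noncomputable def encDisj (P : Finset Plane) : ℕ∞ :=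
  ⨅ (k : ℕ) (_ : ∃ K : Fin k → Set Plane, (∀ i, Convex ℝ (K i)) ∧
    Pairwise (fun i j => Disjoint (K i) (K j)) ∧ Encapsulates K P), (k : ℕ∞)

/-- The largest value of `f` over the `n`-point sets in general position. -/
noncomputable def maxGeneral (f : Finset Plane → ℕ∞) (n : ℕ) : ℕ∞ :=
  ⨆ (P : Finset Plane) (_ : GeneralPosition P ∧ P.card = n), f P

/-- The largest value of `f` over the `n`-point sets in convex position. -/
noncomputable def maxConvex (f : Finset Plane → ℕ∞) (n : ℕ) : ℕ∞ :=
  ⨆ (P : Finset Plane) (_ : ConvexPosition P ∧ P.card = n), f P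

/-- The correction term: `1` for `n = 0, 1, 3` and `0` otherwise. -/
def delta (n : ℕ) : ℕ := if n = 0 ∨ n = 1 ∨ n = 3 then 1 else 0

/-- `⌊(n + 5) / 2⌋ - δ(n)`; the natural-number subtraction never truncates here. -/
def convexBound (n : ℕ) : ℕ := (n + 5) / 2 - delta n

/-- `⌊(2 n + 5) / 3⌋`. -/
def disjointBound (n : ℕ) : ℕ := (2 * n + 5) / 3

/-! Upper bounds come from covers of regions by convex pieces that carry exactly the right part of
their boundary lines. An open half-plane together with a convex part of its boundary is convex, so a
line through two points `x`, `y` of `P` can be shared out: one side keeps the open segment and is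
convex, the other keeps the two outer rays and becomes convex once it is cut along a line from the
segment through a point `e`, which disposes of `e` as well. A convex region needs no more sets than
the points inside it, so this gives recursions. Taking three consecutive points in the angular order
around a hull vertex removes three points with two disjoint sets; this is
`GeneralPosition.regionCov_disjointBound`. If the sets may overlap, `m` disjoint hull edges can be
removed with `m + 1` sets: one outer half-plane per edge, and one common set inside the hull for all
the open edges (`IsEnum.regionCov_matching`). In convex position this yields about `n / 2` sets. In
general position, either eight consecutive points have four such edges (eight points, five sets), or
one of them is not a hull vertex. Through that one there is a line with eight points on one side,
and a hull edge crosses the line; cutting along both removes eleven points with seven sets. For the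
lower bounds let convex sets encapsulate `P` in convex position. If two of them share a point `O` of
the hull, send each `p` to a set that continues the ray from `O` beyond `p`. The two sets through
`O` are never chosen and every other one at most twice, so `n + 4 ≤ 2 k`. Otherwise colour each
point by the sets that reach it; two colours cannot alternate around the polygon. One can choose two
colours at each point so that no pair is repeated. With colours as vertices and points as edges this
is a cactus, and contracting edges and triangles gives `2 n + 3 ≤ 3 k`. The second inequality is the
weaker one precisely where `delta` is `1`. -/

/-! ### Orientations, coordinates along a segment, half-planes with part of their boundary -/

/-- Twice the signed area of the triangle `a b c`. -/
def orient (a b c : Plane) : ℝ := (b 0 - a 0) * (c 1 - a 1) - (b 1 - a 1) * (c 0 - a 0)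

/-- The inner product of `b - a` and `c - a`. -/
def along (a b c : Plane) : ℝ := (b 0 - a 0) * (c 0 - a 0) + (b 1 - a 1) * (c 1 - a 1)

lemma plane_ext {a b : Plane} (h0 : a 0 = b 0) (h1 : a 1 = b 1) : a = b := by
  ext i; fin_cases i
  · exact h0
  · exact h1

lemma orient_comb (a b x y : Plane) {s t : ℝ} (h : s + t = 1) :
    orient a b (s • x + t • y) = s * orient a b x + t * orient a b y := by
  obtain rfl : s = 1 - t := by linarith
  simp [orient]; ring

lemma along_comb (a b x y : Plane) {s t : ℝ} (h : s + t = 1) :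
    along a b (s • x + t • y) = s * along a b x + t * along a b y := by
  obtain rfl : s = 1 - t := by linarith
  simp [along]; ring

lemma orient_rot (a b c : Plane) : orient b c a = orient a b c := by simp only [orient]; ring

lemma orient_swap (a b c : Plane) : orient b a c = -orient a b c := by simp only [orient]; ring

lemma orient_swap_right (a b c : Plane) : orient a c b = -orient a b c := by
  simp only [orient]; ring

@[simp] lemma orient_self_left (a b : Plane) : orient a b a = 0 := by simp [orient]

@[simp] lemma orient_self_right (a b : Plane) : orient a b b = 0 := by simp only [orient]; ring

@[simp] lemma along_self_left (a b : Plane) : along a b a = 0 := by simp [along]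

lemma along_pos {a b : Plane} (h : a ≠ b) : 0 < along a b b := by
  have : b 0 - a 0 ≠ 0 ∨ b 1 - a 1 ≠ 0 := by
    by_contra! hc
    exact h (plane_ext (by linarith [hc.1]) (by linarith [hc.2]))
  unfold along
  rcases this with h | h
  · nlinarith [mul_self_pos.2 h, mul_self_nonneg (b 1 - a 1)]
  · nlinarith [mul_self_pos.2 h, mul_self_nonneg (b 0 - a 0)]

/-- The frame `b - a` and its rotation by a right angle determine a point. -/
lemma frame_fst (a b z : Plane) : along a b b * (z 0 - a 0) =
    along a b z * (b 0 - a 0) - orient a b z * (b 1 - a 1) := by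
  simp only [along, orient]; ring

lemma frame_snd (a b z : Plane) : along a b b * (z 1 - a 1) =
    along a b z * (b 1 - a 1) + orient a b z * (b 0 - a 0) := by
  simp only [along, orient]; ring

lemma frame_ext {a b z w : Plane} (h : a ≠ b) (ho : orient a b z = orient a b w)
    (hs : along a b z = along a b w) : z = w := by
  have hD := along_pos h
  apply plane_ext
  · have h1 := frame_fst a b z
    have h2 := frame_fst a b w
    rw [ho, hs, ← h2] at h1
    linarith [mul_left_cancel₀ hD.ne' h1]
  · have h1 := frame_snd a b z
    have h2 := frame_snd a b w
    rw [ho, hs, ← h2] at h1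
    linarith [mul_left_cancel₀ hD.ne' h1]

/-- The determinant of two vectors in the frame at `a`. -/
lemma frame_orient (a b z w : Plane) : along a b b * orient a z w =
    along a b z * orient a b w - orient a b z * along a b w := by
  simp only [along, orient]; ring

lemma collinear_of_orient_eq_zero {a b c : Plane} (h : a ≠ b) (ho : orient a b c = 0) :
    Collinear ℝ ({a, b, c} : Set Plane) := by
  rw [collinear_iff_of_mem (p₀ := a) (by simp)]
  have hD := along_pos h
  refine ⟨b - a, ?_⟩
  rintro p (rfl | rfl | rfl)
  · exact ⟨0, by simp⟩
  · exact ⟨1, by simp⟩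
  · refine ⟨along a b p / along a b b, ?_⟩
    have h1 := frame_fst a b p
    have h2 := frame_snd a b p
    rw [ho] at h1 h2
    apply plane_ext
    · simp; field_simp; linarith
    · simp; field_simp; linarith

lemma GeneralPosition.orient_ne_zero {P : Finset Plane} (hP : GeneralPosition P) {a b c : Plane}
    (ha : a ∈ P) (hb : b ∈ P) (hc : c ∈ P) (hab : a ≠ b) (hac : a ≠ c) (hbc : b ≠ c) :
    orient a b c ≠ 0 :=
  fun h => hP a ha b hb c hc hab hac hbc (collinear_of_orient_eq_zero hab h)

lemma GeneralPosition.mono {P Q : Finset Plane} (hP : GeneralPosition P) (h : Q ⊆ P) :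
    GeneralPosition Q :=
  fun a ha b hb c hc => hP a (h ha) b (h hb) c (h hc)

lemma ConvexPosition.notMem {P : Finset Plane} (hP : ConvexPosition P) {x : Plane} (hx : x ∈ P) :
    x ∉ convexHull ℝ ((P : Set Plane) \ {x}) :=
  (convexIndependent_set_iff_notMem_convexHull_sdiff (s := (P : Set Plane))).1 hP x hx

lemma ConvexPosition.generalPosition {P : Finset Plane} (hP : ConvexPosition P) :
    GeneralPosition P := by
  have key : ∀ a ∈ P, ∀ b ∈ P, ∀ c ∈ P, a ≠ b → b ≠ c → ¬ Wbtw ℝ a b c := by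
    intro a ha b hb c hc hab hbc h
    refine hP.notMem hb (segment_subset_convexHull (x := a) (y := c) ?_ ?_ ?_)
    · exact ⟨ha, by simpa using hab⟩
    · exact ⟨hc, by simpa using hbc.symm⟩
    · exact h.mem_segment
  intro a ha b hb c hc hab hac hbc h
  rcases h.wbtw_or_wbtw_or_wbtw with h | h | h
  · exact key a ha b hb c hc hab hbc h
  · exact key b hb c hc a ha hbc hac.symm h
  · exact key c hc a ha b hb hac.symm hab h

/-- An open half-plane together with a convex part of its boundary is convex. -/
lemma convex_halfPlane_union {g : Plane → ℝ}
    (hg : ∀ x y : Plane, ∀ s t : ℝ, s + t = 1 → g (s • x + t • y) = s * g x + t * g y)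
    {S : Set Plane} (hS : Convex ℝ S) : Convex ℝ {z | 0 < g z ∨ g z = 0 ∧ z ∈ S} := by
  intro x hx y hy s t hs ht hst
  have hx0 : 0 ≤ g x := by rcases hx with h | h <;> [exact h.le; exact h.1.ge]
  have hy0 : 0 ≤ g y := by rcases hy with h | h <;> [exact h.le; exact h.1.ge]
  have e := hg x y s t hst
  rcases hs.eq_or_lt with rfl | hs'
  · obtain rfl : t = 1 := by linarith
    simpa using hy
  rcases ht.eq_or_lt with rfl | ht'
  · obtain rfl : s = 1 := by linarith
    simpa using hx
  show 0 < g _ ∨ g _ = 0 ∧ _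
  rw [e]
  rcases hx with h | ⟨h, hxS⟩
  · left
    have := mul_pos hs' h
    have := mul_nonneg ht hy0
    linarith
  rcases hy with h' | ⟨h', hyS⟩
  · left
    have := mul_pos ht' h'
    rw [h]; linarith
  · right
    exact ⟨by rw [h, h']; ring, hS hxS hyS hs ht hst⟩

lemma convex_of_affine_lt {g : Plane → ℝ}
    (hg : ∀ x y : Plane, ∀ s t : ℝ, s + t = 1 → g (s • x + t • y) = s * g x + t * g y) (c : ℝ) :
    Convex ℝ {z | c < g z} := by
  intro x hx y hy s t hs ht hst
  show c < g _
  rw [hg x y s t hst]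
  change c < g x at hx
  change c < g y at hy
  rcases hs.eq_or_lt with rfl | hs'
  · obtain rfl : t = 1 := by linarith
    linarith
  · have h1 := mul_lt_mul_of_pos_left hx hs'
    have h2 := mul_le_mul_of_nonneg_left hy.le ht
    have : s * c + t * c = c := by rw [← add_mul, hst, one_mul]
    linarith

lemma neg_affine {g : Plane → ℝ}
    (hg : ∀ x y : Plane, ∀ s t : ℝ, s + t = 1 → g (s • x + t • y) = s * g x + t * g y) :
    ∀ x y : Plane, ∀ s t : ℝ, s + t = 1 →
      (fun z => -g z) (s • x + t • y) = s * (fun z => -g z) x + t * (fun z => -g z) y := by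
  intro x y s t h
  simp only [hg x y s t h]; ring

lemma convex_of_affine_gt {g : Plane → ℝ}
    (hg : ∀ x y : Plane, ∀ s t : ℝ, s + t = 1 → g (s • x + t • y) = s * g x + t * g y) (c : ℝ) :
    Convex ℝ {z | g z < c} := by
  have := convex_of_affine_lt (g := fun z => -g z) (neg_affine hg) (-c)
  simpa using this

lemma convex_along_lt (a b : Plane) (c : ℝ) : Convex ℝ {z | c < along a b z} :=
  convex_of_affine_lt (fun x y _ _ h => along_comb a b x y h) c

lemma convex_along_gt (a b : Plane) (c : ℝ) : Convex ℝ {z | along a b z < c} :=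
  convex_of_affine_gt (fun x y _ _ h => along_comb a b x y h) c

lemma convex_left_union (a b : Plane) {S : Set Plane} (hS : Convex ℝ S) :
    Convex ℝ {z | 0 < orient a b z ∨ orient a b z = 0 ∧ z ∈ S} :=
  convex_halfPlane_union (fun x y _ _ h => orient_comb a b x y h) hS

lemma convex_right_union (a b : Plane) {S : Set Plane} (hS : Convex ℝ S) :
    Convex ℝ {z | orient a b z < 0 ∨ orient a b z = 0 ∧ z ∈ S} := by
  have := convex_halfPlane_union (neg_affine (fun x y _ _ h => orient_comb a b x y h)) hS
    (g := fun z => - orient a b z)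
  simpa using this

/-! ### Covers of regions by convex sets -/

/-- The set `R \ P` is the union of `k` convex sets, pairwise disjoint if `d` holds. -/
def RegionCov (d : Prop) (R : Set Plane) (P : Finset Plane) (k : ℕ) : Prop :=
  ∃ K : Fin k → Set Plane, (∀ i, Convex ℝ (K i)) ∧
    (d → Pairwise (fun i j => Disjoint (K i) (K j))) ∧ ⋃ i, K i = R \ P

lemma RegionCov.union {d : Prop} {R₁ R₂ : Set Plane} {P : Finset Plane} {k₁ k₂ : ℕ}
    (h₁ : RegionCov d R₁ P k₁) (h₂ : RegionCov d R₂ P k₂) (hd : d → Disjoint R₁ R₂) :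
    RegionCov d (R₁ ∪ R₂) P (k₁ + k₂) := by
  obtain ⟨K₁, c₁, d₁, u₁⟩ := h₁
  obtain ⟨K₂, c₂, d₂, u₂⟩ := h₂
  have s₁ : ∀ i, K₁ i ⊆ R₁ := fun i => (Set.subset_iUnion K₁ i).trans (u₁ ▸ Set.sdiff_subset)
  have s₂ : ∀ i, K₂ i ⊆ R₂ := fun i => (Set.subset_iUnion K₂ i).trans (u₂ ▸ Set.sdiff_subset)
  refine ⟨Fin.append K₁ K₂, ?_, ?_, ?_⟩
  · intro i
    refine Fin.addCases (fun i => ?_) (fun i => ?_) i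
    · simpa using c₁ i
    · simpa using c₂ i
  · intro hd' i j
    refine Fin.addCases (fun i => ?_) (fun i => ?_) i <;>
    refine Fin.addCases (fun j => ?_) (fun j => ?_) j <;> intro hij
    · simpa using d₁ hd' (fun h => hij (by rw [h]))
    · simpa using (hd hd').mono (s₁ i) (s₂ j)
    · simpa using ((hd hd').mono (s₁ j) (s₂ i)).symm
    · simpa using d₂ hd' (fun h => hij (by rw [h]))
  · rw [Set.union_sdiff_distrib, ← u₁, ← u₂]
    ext z
    simp only [Set.mem_iUnion, Set.mem_union]
    constructor
    · rintro ⟨i, hi⟩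
      revert hi
      refine Fin.addCases (fun i => ?_) (fun i => ?_) i <;> intro hi
      · exact Or.inl ⟨i, by simpa using hi⟩
      · exact Or.inr ⟨i, by simpa using hi⟩
    · rintro (⟨i, hi⟩ | ⟨i, hi⟩)
      · exact ⟨Fin.castAdd _ i, by simpa using hi⟩
      · exact ⟨Fin.natAdd _ i, by simpa using hi⟩

lemma regionCov_empty (d : Prop) (P : Finset Plane) (k : ℕ) : RegionCov d ∅ P k :=
  ⟨fun _ => ∅, fun _ => convex_empty, fun _ _ _ _ => disjoint_bot_left, by simp⟩

lemma RegionCov.mono {d : Prop} {R : Set Plane} {P : Finset Plane} {k l : ℕ}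
    (h : RegionCov d R P k) (hkl : k ≤ l) : RegionCov d R P l := by
  obtain ⟨m, rfl⟩ := Nat.exists_eq_add_of_le hkl
  simpa using h.union (regionCov_empty d P m) (fun _ => disjoint_bot_right)

lemma RegionCov.congr {d : Prop} {R R' : Set Plane} {P P' : Finset Plane} {k : ℕ}
    (h : RegionCov d R P k) (hR : R \ P = R' \ P') : RegionCov d R' P' k := by
  unfold RegionCov at h ⊢
  rwa [← hR]

lemma RegionCov.inter {d : Prop} {R C : Set Plane} {P : Finset Plane} {k : ℕ}
    (h : RegionCov d R P k) (hC : Convex ℝ C) : RegionCov d (R ∩ C) P k := by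
  obtain ⟨K, c, hd, u⟩ := h
  refine ⟨fun i => K i ∩ C, fun i => (c i).inter hC, fun h i j hij =>
    (hd h hij).mono Set.inter_subset_left Set.inter_subset_left, ?_⟩
  rw [← Set.iUnion_inter, u]
  ext z; simp only [Set.mem_inter_iff, Set.mem_sdiff]; tauto

/-- A convex region inherits a cover of the complement of its points. -/
lemma RegionCov.restrict {d : Prop} {C : Set Plane} {P Q : Finset Plane} {k : ℕ}
    (h : RegionCov d Set.univ Q k) (hC : Convex ℝ C) (hQ : ∀ z ∈ C, z ∈ P ↔ z ∈ Q) :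
    RegionCov d C P k := by
  refine (h.inter hC).congr ?_
  ext z
  simp only [Set.univ_inter, Set.mem_sdiff, Finset.mem_coe]
  constructor <;> rintro ⟨h1, h2⟩ <;> exact ⟨h1, by have := hQ z h1; tauto⟩

lemma regionCov_univ_empty (d : Prop) : RegionCov d Set.univ ∅ 1 :=
  ⟨fun _ => Set.univ, fun _ => convex_univ, fun _ i j h => absurd (Subsingleton.elim i j) h,
    by simp [Set.iUnion_const]⟩

lemma regionCov_of_convex (d : Prop) {C : Set Plane} {P : Finset Plane} (hC : Convex ℝ C)
    (h : ∀ z ∈ C, z ∉ P) : RegionCov d C P 1 :=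
  (regionCov_univ_empty d).restrict hC (fun z hz => by simp [h z hz])


/-! ### Cutting along a line through two points -/

/-- The points left of the directed line `x y`, with the part of the line outside `[x, y]`. -/
def leftRegion (x y : Plane) : Set Plane :=
  {z | 0 < orient x y z ∨ orient x y z = 0 ∧ (along x y z < 0 ∨ along x y y < along x y z)}

/-- The points right of the directed line `x y`, with the open segment from `x` to `y`. -/
def rightRegion (x y : Plane) : Set Plane :=
  {z | orient x y z < 0 ∨ orient x y z = 0 ∧ 0 < along x y z ∧ along x y z < along x y y}

lemma convex_rightRegion (x y : Plane) : Convex ℝ (rightRegion x y) :=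
  convex_right_union x y ((convex_along_lt x y 0).inter (convex_along_gt x y _))

lemma mem_leftRegion_or_rightRegion {x y z : Plane} (hxy : x ≠ y) (hx : z ≠ x) (hy : z ≠ y) :
    z ∈ leftRegion x y ∨ z ∈ rightRegion x y := by
  rcases lt_trichotomy (orient x y z) 0 with h | h | h
  · exact Or.inr (Or.inl h)
  · have h0 : along x y z ≠ 0 := fun h' => hx (frame_ext hxy (by simp [h]) (by simp [h']))
    have h1 : along x y z ≠ along x y y := fun h' => hy (frame_ext hxy (by simp [h]) h')
    rcases lt_or_gt_of_ne h0 with h2 | h2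
    · exact Or.inl (Or.inr ⟨h, Or.inl h2⟩)
    · rcases lt_or_gt_of_ne h1 with h3 | h3
      · exact Or.inr (Or.inr ⟨h, h2, h3⟩)
      · exact Or.inl (Or.inr ⟨h, Or.inr h3⟩)
  · exact Or.inl (Or.inl h)

lemma disjoint_leftRegion_rightRegion (x y : Plane) :
    Disjoint (leftRegion x y) (rightRegion x y) := by
  rw [Set.disjoint_left]
  rintro z (h | ⟨h, h2⟩) (h' | ⟨h', h3, h4⟩)
  · linarith
  · linarith
  · linarith
  · rcases h2 with h2 | h2 <;> linarith

/-- A point of the open segment from `x` to `y` that lies on no line through two points of `L`. -/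
lemma exists_generic_on_segment {x y : Plane} {L : Finset Plane}
    (hL : ∀ f ∈ L, ∀ g ∈ L, f ≠ g → orient f g x ≠ 0) :
    ∃ c : ℝ, 0 < c ∧ c < 1 ∧ ∀ f ∈ L, ∀ g ∈ L, f ≠ g → orient f g ((1 - c) • x + c • y) ≠ 0 := by
  have hfin : Set.Finite (⋃ p ∈ (L ×ˢ L : Finset (Plane × Plane)),
      {c : ℝ | p.1 ≠ p.2 ∧ orient p.1 p.2 ((1 - c) • x + c • y) = 0}) := by
    refine Set.Finite.biUnion (Finset.finite_toSet _) ?_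
    rintro ⟨f, g⟩ hfg
    rw [Finset.mem_coe, Finset.mem_product] at hfg
    -- The orientation is affine in `c` and nonzero at `c = 0`, where the point is `x`, so it has at
    -- most one root.
    apply Set.Subsingleton.finite
    rintro c ⟨hc, hc'⟩ e ⟨-, he⟩
    dsimp only at *
    rw [orient_comb f g x y (by ring)] at hc' he
    have h0 := hL f hfg.1 g hfg.2 hc
    by_contra hne
    have h1 : (c - e) * (orient f g y - orient f g x) = 0 := by linarith
    rcases mul_eq_zero.1 h1 with h2 | h2
    · exact hne (by linarith)
    · apply h0
      have : orient f g y = orient f g x := by linarith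
      rw [this] at hc'; linarith
  obtain ⟨c, hc, hc'⟩ := (Set.Ioo_infinite (zero_lt_one' ℝ)).exists_notMem_finite hfin
  refine ⟨c, hc.1, hc.2, fun f hf g hg hfg h => hc' ?_⟩
  simp only [Set.mem_iUnion]
  exact ⟨(f, g), Finset.mem_product.2 ⟨hf, hg⟩, hfg, h⟩

/-- Some point `e` of `L` is the first one in the angular order around a point of the open
segment from `x` to `y`. -/
lemma exists_first_point {P L : Finset Plane} (hP : GeneralPosition P) {x y : Plane}
    (hx : x ∈ P) (hxy : x ≠ y) (hL : ∀ f ∈ L, f ∈ P ∧ 0 < orient x y f)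
    (hne : L.Nonempty) :
    ∃ c : ℝ, 0 < c ∧ c < 1 ∧ ∃ e ∈ L, ∀ f ∈ L, f ≠ e →
      0 < orient ((1 - c) • x + c • y) e f := by
  obtain ⟨c, h0, h1, hc⟩ := exists_generic_on_segment (x := x) (y := y) (L := L) (by
    intro f hf g hg hfg
    have hfx : f ≠ x := by rintro rfl; have := (hL _ hf).2; simp at this
    have hgx : g ≠ x := by rintro rfl; have := (hL _ hg).2; simp at this
    exact hP.orient_ne_zero (hL f hf).1 (hL g hg).1 hx hfg hfx hgx)
  refine ⟨c, h0, h1, ?_⟩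
  set Z := (1 - c) • x + c • y with hZ
  -- The quotient is the cotangent of the angle at `Z` between the direction of `y` and that of `f`;
  -- its maximum is the smallest angle. Genericity of `c` excludes ties.
  obtain ⟨e, he, hmax⟩ := L.exists_max_image
    (fun f => (along x y f - along x y Z) / orient x y f) hne
  refine ⟨e, he, fun f hf hfe => ?_⟩
  have hoe := (hL e he).2
  have hof := (hL f hf).2
  have hD := along_pos hxy
  have hm := hmax f hf
  rw [div_le_div_iff₀ hof hoe] at hm
  have hZo : orient x y Z = 0 := by rw [hZ, orient_comb x y x y (by ring)]; simp
  have key : along x y y * orient Z e f = (along x y e - along x y Z) * orient x y f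
      - (along x y f - along x y Z) * orient x y e := by
    have h1 := frame_orient x y e f
    have h2 := frame_orient x y Z e
    have h3 := frame_orient x y Z f
    rw [hZo] at h2 h3
    have h4 : orient Z e f = orient x e f - orient x Z f + orient x Z e := by
      simp only [orient]; ring
    rw [h4]; linarith
  have hge : 0 ≤ along x y y * orient Z e f := by rw [key]; linarith
  have hge' : 0 ≤ orient Z e f := nonneg_of_mul_nonneg_right hge hD
  refine lt_of_le_of_ne hge' (fun h => hc e he f hf hfe.symm ?_)
  rw [← orient_rot, orient_rot, orient_rot, h]

/-- If the points strictly left of `x y`, one of them omitted, need `m` sets, then the left region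
needs one more. -/
lemma regionCov_leftRegion {d : Prop} {P L : Finset Plane} (hP : GeneralPosition P) {x y : Plane}
    (hx : x ∈ P) (hy : y ∈ P) (hxy : x ≠ y) (hL : ∀ f, f ∈ L ↔ f ∈ P ∧ 0 < orient x y f)
    (hne : L.Nonempty) {m : ℕ} (hm : ∀ e ∈ L, RegionCov d Set.univ (L.erase e) m) :
    RegionCov d (leftRegion x y) P (m + 1) := by
  obtain ⟨c, hc0, hc1, e, he, hfirst⟩ :=
    exists_first_point hP hx hxy (fun f hf => (hL f).1 hf) hne
  set Z := (1 - c) • x + c • y with hZ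
  have hoe := ((hL e).1 he).2
  have hD := along_pos hxy
  have hZo : orient x y Z = 0 := by rw [hZ, orient_comb x y x y (by ring)]; simp
  have hZs : along x y Z = c * along x y y := by rw [hZ, along_comb x y x y (by ring)]; simp
  have hZe : Z ≠ e := by rintro h; rw [← h, hZo] at hoe; exact lt_irrefl _ hoe
  have hD' := along_pos hZe
  -- On the line `x y` the side of `Z e` depends only on the position relative to `Z`, so the ray
  -- behind `x` and the ray beyond `y` fall on different sides.
  have hline : ∀ z, orient x y z = 0 →
      along x y y * orient Z e z = (along x y Z - along x y z) * orient x y e := by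
    intro z hz
    have h1 := frame_orient x y e z
    have h2 := frame_orient x y Z e
    have h3 := frame_orient x y Z z
    rw [hZo] at h2 h3
    rw [hz] at h1 h3
    have h4 : orient Z e z = orient x e z - orient x Z z + orient x Z e := by
      simp only [orient]; ring
    rw [h4]; linarith
  have hnotP : ∀ z ∈ P, orient x y z = 0 → along x y z = 0 ∨ along x y z = along x y y := by
    intro z hz h
    by_cases h1 : z = x
    · left; simp [h1]
    by_cases h2 : z = y
    · right; simp [h2]
    exact absurd h (hP.orient_ne_zero hx hy hz hxy (Ne.symm h1) (Ne.symm h2))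
  -- The line `Z e` is divided at `e`: `A` takes the part before `e`, `B` the part beyond it, and
  -- `e` is in neither. As `e` is first in the angular order, `B` contains no point of `P`, and
  -- those in `A` are in `L.erase e`.
  let A : Set Plane := {z | 0 < orient x y z ∨ orient x y z = 0 ∧ z ∈ {z | along x y z < 0}} ∩
    {z | 0 < orient Z e z ∨ orient Z e z = 0 ∧ z ∈ {z | along Z e z < along Z e e}}
  let B : Set Plane :=
    {z | 0 < orient x y z ∨ orient x y z = 0 ∧ z ∈ {z | along x y y < along x y z}} ∩
    {z | orient Z e z < 0 ∨ orient Z e z = 0 ∧ z ∈ {z | along Z e e < along Z e z}}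
  have hA : Convex ℝ A := (convex_left_union x y (convex_along_gt x y _)).inter
    (convex_left_union Z e (convex_along_gt Z e _))
  have hB : Convex ℝ B := (convex_left_union x y (convex_along_lt x y _)).inter
    (convex_right_union Z e (convex_along_lt Z e _))
  have hcA : RegionCov d A P m := by
    refine (hm e he).restrict hA ?_
    rintro z ⟨h1, h2⟩
    rw [Finset.mem_erase, hL]
    constructor
    · intro hz
      refine ⟨?_, hz, ?_⟩
      · rintro rfl
        rcases h2 with h2 | ⟨-, h2⟩
        · simp at h2
        · exact lt_irrefl (along Z z z) h2
      · rcases h1 with h1 | ⟨h1, h3⟩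
        · exact h1
        · change along x y z < 0 at h3
          rcases hnotP z hz h1 with h | h <;> linarith
    · exact fun h => h.2.1
  have hcB : RegionCov d B P 1 := by
    refine regionCov_of_convex d hB ?_
    rintro z ⟨h1, h2⟩ hz
    have h1' : 0 < orient x y z := by
      rcases h1 with h1 | ⟨h1, h3⟩
      · exact h1
      · change along x y y < along x y z at h3
        rcases hnotP z hz h1 with h | h <;> linarith
    by_cases hze : z = e
    · subst hze
      rcases h2 with h2 | ⟨-, h2⟩
      · simp at h2
      · exact lt_irrefl (along Z z z) h2
    · have := hfirst z ((hL z).2 ⟨hz, h1'⟩) hze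
      rcases h2 with h2 | ⟨h2, -⟩ <;> linarith
  refine (hcA.union hcB ?_).congr ?_
  · intro _
    rw [Set.disjoint_left]
    rintro z ⟨-, h⟩ ⟨-, h'⟩
    rcases h with h | ⟨h, h2⟩ <;> rcases h' with h' | ⟨h', h3⟩
    · linarith
    · linarith
    · linarith
    · exact lt_asymm (a := along Z e z) h2 h3
  · ext z
    simp only [Set.mem_sdiff, Finset.mem_coe]
    refine and_congr_left (fun hz => ?_)
    constructor
    · rintro (⟨h1 | ⟨h1, h2⟩, -⟩ | ⟨h1 | ⟨h1, h2⟩, -⟩)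
      · exact Or.inl h1
      · exact Or.inr ⟨h1, Or.inl h2⟩
      · exact Or.inl h1
      · exact Or.inr ⟨h1, Or.inr h2⟩
    · rintro (h | ⟨h, h2 | h2⟩)
      · rcases lt_trichotomy (orient Z e z) 0 with h3 | h3 | h3
        · exact Or.inr ⟨Or.inl h, Or.inl h3⟩
        · rcases lt_trichotomy (along Z e z) (along Z e e) with h4 | h4 | h4
          · exact Or.inl ⟨Or.inl h, Or.inr ⟨h3, h4⟩⟩
          · exfalso
            apply hz
            rw [frame_ext hZe (by rw [h3]; simp) h4]
            exact ((hL e).1 he).1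
          · exact Or.inr ⟨Or.inl h, Or.inr ⟨h3, h4⟩⟩
        · exact Or.inl ⟨Or.inl h, Or.inl h3⟩
      · refine Or.inl ⟨Or.inr ⟨h, h2⟩, Or.inl ?_⟩
        have h3 := hline z h
        have : 0 < along x y Z - along x y z := by
          rw [hZs]; nlinarith [mul_pos hc0 hD]
        have h4 := mul_pos this hoe
        rw [← h3] at h4
        exact pos_of_mul_pos_right h4 hD.le
      · refine Or.inr ⟨Or.inr ⟨h, h2⟩, Or.inl ?_⟩
        have h3 := hline z h
        have : along x y Z - along x y z < 0 := by
          rw [hZs]; nlinarith [mul_pos (sub_pos.2 hc1) hD]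
        have h4 := mul_neg_of_neg_of_pos this hoe
        rw [← h3] at h4
        exact (pos_iff_neg_of_mul_neg h4).1 hD

/-- Splitting a point set by the line through two of its points. -/
lemma regionCov_split {d : Prop} {P L : Finset Plane} (hP : GeneralPosition P) {x y : Plane}
    (hx : x ∈ P) (hy : y ∈ P) (hxy : x ≠ y) (hL : ∀ f, f ∈ L ↔ f ∈ P ∧ 0 < orient x y f)
    (hne : L.Nonempty) {m k : ℕ} (hm : ∀ e ∈ L, RegionCov d Set.univ (L.erase e) m)
    {R : Finset Plane} (hR : ∀ f, f ∈ R ↔ f ∈ P ∧ orient x y f < 0)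
    (hk : RegionCov d Set.univ R k) : RegionCov d Set.univ P (m + 1 + k) := by
  refine ((regionCov_leftRegion hP hx hy hxy hL hne hm).union
    (hk.restrict (convex_rightRegion x y) (P := P) ?_)
    (fun _ => disjoint_leftRegion_rightRegion x y)).congr ?_
  · intro z hz
    rw [hR]
    refine ⟨fun h => ⟨h, ?_⟩, fun h => h.1⟩
    rcases hz with hz | ⟨hz, h1, h2⟩
    · exact hz
    · have h3 : z ≠ x := by rintro rfl; simp at h1
      have h4 : z ≠ y := by rintro rfl; exact lt_irrefl _ h2
      exact absurd hz (hP.orient_ne_zero hx hy h hxy h3.symm h4.symm)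
  · ext z
    simp only [Set.mem_sdiff, Finset.mem_coe, Set.mem_univ, true_and, Set.mem_union]
    refine ⟨fun h => h.2, fun h => ⟨mem_leftRegion_or_rightRegion hxy ?_ ?_, h⟩⟩
    · rintro rfl; exact h hx
    · rintro rfl; exact h hy


/-! ### Angular order around a hull vertex and the bound for disjoint sets -/

/-- A finite set can be listed in increasing order of an injective real key. -/
lemma exists_enum_of_key {α : Type*} [DecidableEq α] (Q : Finset α) (κ : α → ℝ)
    (hκ : Set.InjOn κ Q) (a₀ : α) :
    ∃ f : ℕ → α, Q = (Finset.range Q.card).image f ∧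
      ∀ i j, i < j → j < Q.card → κ (f i) < κ (f j) := by
  induction Q using Finset.induction_on_max_value κ with
  | empty => exact ⟨fun _ => a₀, by simp, by simp⟩
  | insert a s ha hmax ih =>
    obtain ⟨f, hf, hlt⟩ := ih (hκ.mono (by simp))
    rw [Finset.card_insert_of_notMem ha]
    have hfs : ∀ i < s.card, f i ∈ s := fun i hi => by
      rw [hf]; exact Finset.mem_image_of_mem f (Finset.mem_range.2 hi)
    refine ⟨fun i => if i = s.card then a else f i, ?_, ?_⟩
    · rw [Finset.range_add_one, Finset.image_insert]
      simp only [if_true]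
      congr 1
      conv_lhs => rw [hf]
      refine Finset.image_congr fun i hi => ?_
      rw [Finset.mem_coe, Finset.mem_range] at hi
      simp [hi.ne]
    · intro i j hij hj
      by_cases hjs : j = s.card
      · subst hjs
        simp only [hij.ne, if_false, if_true]
        refine lt_of_le_of_ne (hmax _ (hfs i hij)) (fun h => ?_)
        have := hκ (Finset.mem_insert_of_mem (hfs i hij)) (Finset.mem_insert_self a s) h
        exact ha (this ▸ hfs i hij)
      · have hj' : j < s.card := by omega
        simp only [hjs, (hij.trans hj').ne, if_false]
        exact hlt i j hij hj'

/-- The values `f 0, …, f (card P - 1)` list the elements of `P` without repetition. -/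
structure IsEnum (P : Finset Plane) (f : ℕ → Plane) : Prop where
  mem : ∀ i, i < P.card → f i ∈ P
  exists_index : ∀ z ∈ P, ∃ i < P.card, f i = z
  ne : ∀ i j, i < P.card → j < P.card → i ≠ j → f i ≠ f j

/-- Points in general position can be listed in counterclockwise order around a vertex of their
convex hull. -/
lemma GeneralPosition.exists_enum {P : Finset Plane} (hP : GeneralPosition P) :
    ∃ f : ℕ → Plane, IsEnum P f ∧ ∀ i j, 0 < i → i < j → j < P.card → 0 < orient (f 0) (f i) (f j) := by
  classical
  rcases P.eq_empty_or_nonempty with rfl | hne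
  · exact ⟨fun _ => 0, ⟨by simp, by simp, by simp⟩, by simp⟩
  -- A point farthest from the origin is a hull vertex: every other `z` has `g z > 0`, hence lies in
  -- an open half-plane bounded by a line through `v`. There `c z / g z` is a slope that orders the
  -- directions from `v`.
  obtain ⟨v, hv, hmax⟩ := P.exists_max_image (fun z => z 0 * z 0 + z 1 * z 1) hne
  set g : Plane → ℝ := fun z => v 0 * (v 0 - z 0) + v 1 * (v 1 - z 1) with hg
  set c : Plane → ℝ := fun z => v 0 * (z 1 - v 1) - v 1 * (z 0 - v 0) with hc
  have hgpos : ∀ z ∈ P.erase v, 0 < g z := by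
    intro z hz
    rw [Finset.mem_erase] at hz
    have h1 := hmax z hz.2
    have h2 : v 0 - z 0 ≠ 0 ∨ v 1 - z 1 ≠ 0 := by
      by_contra! h
      exact hz.1 (plane_ext (by linarith [h.1]) (by linarith [h.2]))
    simp only [hg]
    rcases h2 with h | h
    · nlinarith [mul_self_pos.2 h, mul_self_nonneg (v 1 - z 1)]
    · nlinarith [mul_self_pos.2 h, mul_self_nonneg (v 0 - z 0)]
  have hcross : ∀ z w, (v 0 * v 0 + v 1 * v 1) * orient v z w = c z * g w - c w * g z := by
    intro z w
    simp only [hg, hc, orient]; ring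
  -- The origin can be farthest only if it is the sole point.
  have hvpos : ∀ z ∈ P.erase v, 0 < v 0 * v 0 + v 1 * v 1 := by
    intro z hz
    have h := hgpos z hz
    by_contra hcon
    have h0 : v 0 = 0 := by nlinarith [mul_self_nonneg (v 0), mul_self_nonneg (v 1)]
    have h1 : v 1 = 0 := by nlinarith [mul_self_nonneg (v 0), mul_self_nonneg (v 1)]
    simp [hg, h0, h1] at h
  have hinj : Set.InjOn (fun z => -(c z / g z)) (P.erase v) := by
    intro z hz w hw h
    have hz' := hz
    have hw' := hw
    rw [Finset.mem_coe, Finset.mem_erase] at hz' hw'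
    by_contra hzw
    have h1 : c z / g z = c w / g w := neg_injective h
    rw [div_eq_div_iff (hgpos z hz).ne' (hgpos w hw).ne'] at h1
    have h2 := hcross z w
    rw [h1, sub_self] at h2
    rcases mul_eq_zero.1 h2 with h3 | h3
    · exact (hvpos z hz).ne' h3
    · exact hP.orient_ne_zero hv hz'.2 hw'.2 (Ne.symm hz'.1) (Ne.symm hw'.1) hzw h3
  obtain ⟨f, hf, hlt⟩ := exists_enum_of_key (P.erase v) _ hinj v
  have hcard : (P.erase v).card + 1 = P.card := Finset.card_erase_add_one hv
  have hmem : ∀ i < (P.erase v).card, f i ∈ P.erase v := fun i hi => by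
    rw [hf]; exact Finset.mem_image_of_mem f (Finset.mem_range.2 hi)
  have himage : P = (Finset.range P.card).image (fun i => if i = 0 then v else f (i - 1)) := by
    rw [← hcard, Finset.range_eq_Ico, ← Finset.insert_Ico_add_one_left_eq_Ico (by omega),
      Finset.image_insert, if_pos rfl]
    conv_lhs => rw [← Finset.insert_erase hv, hf]
    congr 1
    ext z
    simp only [Finset.mem_image, Finset.mem_range, Finset.mem_Ico]
    constructor
    · rintro ⟨i, hi, rfl⟩
      exact ⟨i + 1, by omega, by simp⟩
    · rintro ⟨i, hi, rfl⟩
      exact ⟨i - 1, by omega, by rw [if_neg (by omega)]⟩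
  refine ⟨fun i => if i = 0 then v else f (i - 1), ⟨?_, ?_, ?_⟩, ?_⟩
  · intro i hi
    have := Finset.mem_image_of_mem (fun i => if i = 0 then v else f (i - 1))
      (Finset.mem_range.2 hi)
    rwa [← himage] at this
  · intro z hz
    rw [himage] at hz
    simpa using hz
  · have h1 : ((Finset.range P.card).image (fun i => if i = 0 then v else f (i - 1))).card
        = (Finset.range P.card).card := by rw [← himage, Finset.card_range]
    rw [Finset.card_image_iff] at h1
    intro i j hi hj hij h
    exact hij (h1 (by simpa using hi) (by simpa using hj) h)
  · intro i j hi hij hj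
    simp only [if_true, hi.ne', (hi.trans hij).ne', if_false]
    have hi' : f (i - 1) ∈ P.erase v := hmem _ (by omega)
    have hj' : f (j - 1) ∈ P.erase v := hmem _ (by omega)
    have h1 := hlt (i - 1) (j - 1) (by omega) (by omega)
    have h2 := hcross (f (i - 1)) (f (j - 1))
    have h3 : c (f (j - 1)) / g (f (j - 1)) < c (f (i - 1)) / g (f (i - 1)) := by linarith
    rw [div_lt_div_iff₀ (hgpos _ hj') (hgpos _ hi')] at h3
    have h4 : 0 < (v 0 * v 0 + v 1 * v 1) * orient v (f (i - 1)) (f (j - 1)) := by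
      rw [h2]; linarith
    exact pos_of_mul_pos_right h4 (hvpos _ hi').le

/-- The points lie on one line and cut it into `P.card + 1` pieces. Two pieces join the two open
half-planes; for two points the third piece, a ray, is a set of its own. -/
lemma regionCov_univ_of_card_le_two (d : Prop) {P : Finset Plane} (h : P.card ≤ 2) :
    RegionCov d Set.univ P (P.card + 1) := by
  classical
  have hcard : P.card = 0 ∨ P.card = 1 ∨ P.card = 2 := by omega
  have hdir : ∃ a b : Plane, a ≠ b ∧ (∀ z ∈ P, orient a b z = 0) := by
    rcases hcard with h | h | h
    · rw [Finset.card_eq_zero] at h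
      subst h
      obtain ⟨a, b, hab⟩ := exists_pair_ne Plane
      exact ⟨a, b, hab, by simp⟩
    · obtain ⟨a, rfl⟩ := Finset.card_eq_one.1 h
      obtain ⟨b, hb⟩ := exists_ne a
      exact ⟨a, b, hb.symm, by simp⟩
    · obtain ⟨a, b, hab, rfl⟩ := Finset.card_eq_two.1 h
      exact ⟨a, b, hab, by simp⟩
  obtain ⟨a, b, hab, hline⟩ := hdir
  rcases hcard with h | h | h
  · rw [h, Finset.card_eq_zero.1 h]
    exact regionCov_univ_empty d
  · obtain ⟨p, rfl⟩ := Finset.card_eq_one.1 h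
    have hp := hline p (by simp)
    have hA := regionCov_of_convex d (P := {p})
      (convex_left_union a b (convex_along_gt a b (along a b p))) (by
        rintro z hz h
        rw [Finset.mem_singleton] at h
        subst h
        rcases hz with hz | ⟨-, hz⟩
        · linarith
        · exact lt_irrefl (along a b z) hz)
    have hB := regionCov_of_convex d (P := {p})
      (convex_right_union a b (convex_along_lt a b (along a b p))) (by
        rintro z hz h
        rw [Finset.mem_singleton] at h
        subst h
        rcases hz with hz | ⟨-, hz⟩
        · linarith
        · exact lt_irrefl (along a b z) hz)
    rw [h]
    refine (hA.union hB (fun _ => ?_)).congr ?_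
    · rw [Set.disjoint_left]
      rintro z (h | ⟨h, h2⟩) (h' | ⟨h', h3⟩)
      · linarith
      · linarith
      · linarith
      · exact lt_asymm (a := along a b z) h2 h3
    · ext z
      simp only [Set.mem_sdiff, Set.mem_univ, true_and, Set.mem_union, and_iff_right_iff_imp,
        Finset.mem_coe, Finset.mem_singleton]
      intro hz
      rcases lt_trichotomy (orient a b z) 0 with h1 | h1 | h1
      · exact Or.inr (Or.inl h1)
      · rcases lt_trichotomy (along a b z) (along a b p) with h2 | h2 | h2
        · exact Or.inl (Or.inr ⟨h1, h2⟩)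
        · exact absurd (frame_ext hab (by rw [h1, hp]) h2) hz
        · exact Or.inr (Or.inr ⟨h1, h2⟩)
      · exact Or.inl (Or.inl h1)
  · obtain ⟨x, y, hxy, rfl⟩ := Finset.card_eq_two.1 h
    rw [h]
    have hA := regionCov_of_convex d (P := {x, y})
      (convex_left_union x y (convex_along_gt x y 0)) (by
        rintro z hz h
        simp only [Finset.mem_insert, Finset.mem_singleton] at h
        rcases h with rfl | rfl
        · rcases hz with hz | ⟨-, hz⟩
          · simp at hz
          · simp at hz
        · rcases hz with hz | ⟨-, hz⟩
          · simp at hz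
          · have hz' : along x z z < 0 := hz
            linarith [along_pos hxy])
    have hM : RegionCov d {z | orient x y z = 0 ∧ along x y y < along x y z} {x, y} 1 := by
      refine regionCov_of_convex d ?_ ?_
      · intro p hp q hq s t hs ht hst
        refine ⟨?_, convex_along_lt x y _ hp.2 hq.2 hs ht hst⟩
        rw [orient_comb x y p q hst, hp.1, hq.1]; ring
      · rintro z ⟨h1, h2⟩ h
        simp only [Finset.mem_insert, Finset.mem_singleton] at h
        rcases h with rfl | rfl
        · simp at h2; linarith [along_pos hxy]
        · exact lt_irrefl _ h2
    have hB := regionCov_of_convex d (P := {x, y}) (convex_rightRegion x y) (by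
        rintro z hz h
        simp only [Finset.mem_insert, Finset.mem_singleton] at h
        rcases h with rfl | rfl
        · rcases hz with hz | ⟨-, hz, -⟩ <;> simp at hz
        · rcases hz with hz | ⟨-, -, hz⟩ <;> simp at hz)
    have hAM := hA.union hM (fun _ => by
      rw [Set.disjoint_left]
      rintro z (h | ⟨h, h2⟩) ⟨h', h3⟩
      · linarith
      · have hz' : along x y z < 0 := h2
        linarith [along_pos hxy])
    have hlr : {z | 0 < orient x y z ∨ orient x y z = 0 ∧ z ∈ {z | along x y z < 0}} ∪
        {z | orient x y z = 0 ∧ along x y y < along x y z} = leftRegion x y := by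
      ext z
      simp only [leftRegion, Set.mem_union, Set.mem_ofPred_eq]
      tauto
    rw [hlr] at hAM
    refine (hAM.union hB (fun _ => disjoint_leftRegion_rightRegion x y)).congr ?_
    ext z
    simp only [Set.mem_sdiff, Set.mem_univ, true_and, Set.mem_union, and_iff_right_iff_imp,
        Finset.mem_coe, Finset.mem_singleton, Finset.mem_insert, not_or]
    exact fun hz => mem_leftRegion_or_rightRegion hxy hz.1 hz.2

/-- The complement of `n` points in general position is the union of `⌊(2n + 5) / 3⌋` disjoint
convex sets. -/
theorem GeneralPosition.regionCov_disjointBound (d : Prop) {P : Finset Plane}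
    (hP : GeneralPosition P) : RegionCov d Set.univ P (disjointBound P.card) := by
  classical
  induction hn : P.card using Nat.strong_induction_on generalizing P with
  | _ n ih =>
  subst hn
  by_cases h2 : P.card ≤ 2
  · refine (regionCov_univ_of_card_le_two d h2).mono ?_
    unfold disjointBound; omega
  obtain ⟨f, ⟨hmem, hex, hne⟩, hpos⟩ := hP.exists_enum
  -- The line from `f 2` to the hull vertex `f 0` has only `f 1` on its left.
  have hcond : ∀ i < P.card, (0 < orient (f 2) (f 0) (f i) ↔ i = 1) ∧
      (orient (f 2) (f 0) (f i) < 0 ↔ 3 ≤ i) := by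
    intro i hi
    have e : orient (f 2) (f 0) (f i) = orient (f 0) (f i) (f 2) := by rw [← orient_rot]
    rcases (by omega : i = 0 ∨ i = 1 ∨ i = 2 ∨ 3 ≤ i) with rfl | rfl | rfl | h
    · simp
    · have := hpos 1 2 (by omega) (by omega) (by omega)
      rw [e]; constructor <;> constructor <;> intro h <;> first | omega | linarith
    · simp
    · have := hpos 2 i (by omega) (by omega) (by omega)
      rw [← orient_rot, orient_swap_right] at e
      have e' : orient (f 2) (f 0) (f i) = -orient (f 0) (f 2) (f i) := orient_swap _ _ _
      rw [e']
      constructor <;> constructor <;> intro h <;> first | omega | linarith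
  set R := P \ {f 0, f 1, f 2} with hR
  have hsub : ({f 0, f 1, f 2} : Finset Plane) ⊆ P := by
    intro z hz
    simp only [Finset.mem_insert, Finset.mem_singleton] at hz
    rcases hz with rfl | rfl | rfl <;> exact hmem _ (by omega)
  have hcard : R.card = P.card - 3 := by
    rw [hR, Finset.card_sdiff_of_subset hsub, Finset.card_eq_three.2
      ⟨f 0, f 1, f 2, hne _ _ (by omega) (by omega) (by omega),
        hne _ _ (by omega) (by omega) (by omega), hne _ _ (by omega) (by omega) (by omega), rfl⟩]
  have hrest := ih R.card (by omega) (hP.mono (Finset.sdiff_subset)) rfl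
  -- Three points cost two sets: on the left nothing remains once `f 1` is dropped, so `m = 1`, and
  -- one more set is needed for the cut through `f 1`.
  refine (regionCov_split hP (hmem 2 (by omega)) (hmem 0 (by omega))
    (hne 2 0 (by omega) (by omega) (by omega)) (L := {f 1}) ?_ (by simp) (m := 1) ?_ (R := R) ?_
    hrest).mono ?_
  · intro z
    rw [Finset.mem_singleton]
    constructor
    · rintro rfl
      exact ⟨hmem 1 (by omega), (hcond 1 (by omega)).1.2 rfl⟩
    · rintro ⟨hz, h⟩
      obtain ⟨i, hi, rfl⟩ := hex z hz
      rw [(hcond i hi).1.1 h]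
  · intro e he
    rw [Finset.mem_singleton.1 he, Finset.erase_singleton]
    exact regionCov_univ_empty d
  · intro z
    rw [hR, Finset.mem_sdiff]
    refine and_congr_right (fun hz => ?_)
    obtain ⟨i, hi, rfl⟩ := hex z hz
    rw [(hcond i hi).2]
    simp only [Finset.mem_insert, Finset.mem_singleton, not_or]
    constructor
    · rintro ⟨h0, h1, h2⟩
      by_contra hlt
      rcases (by omega : i = 0 ∨ i = 1 ∨ i = 2) with rfl | rfl | rfl
      · exact h0 rfl
      · exact h1 rfl
      · exact h2 rfl
    · intro h
      exact ⟨hne _ _ hi (by omega) (by omega), hne _ _ hi (by omega) (by omega),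
        hne _ _ hi (by omega) (by omega)⟩
  · rw [hcard]; unfold disjointBound; omega


/-! ### Matchings of hull edges and the bound for convex position -/

/-- Disjoint hull edges `f 0 f 1`, `f 2 f 3`, … whose hull contains no further point: each edge
costs one set, and one more set covers the interiors of all the edges. -/
lemma IsEnum.regionCov_matching {P : Finset Plane} {f : ℕ → Plane} (hf : IsEnum P f) {m : ℕ}
    (hm : 2 * m ≤ P.card)
    (hedge : ∀ i < m, ∀ z ∈ P, z ≠ f (2 * i) → z ≠ f (2 * i + 1) →
      0 < orient (f (2 * i)) (f (2 * i + 1)) z)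
    (hconv : ∀ j < P.card, 2 * m ≤ j → f j ∉ convexHull ℝ (f '' Set.Iio (2 * m)))
    {Q : Finset Plane} (hQ : ∀ z, z ∈ Q ↔ ∃ j, 2 * m ≤ j ∧ j < P.card ∧ f j = z) {k : ℕ}
    (hk : RegionCov False Set.univ Q k) : RegionCov False Set.univ P (m + 1 + k) := by
  let a : ℕ → Plane := fun i => f (2 * i)
  let b : ℕ → Plane := fun i => f (2 * i + 1)
  have hab : ∀ i < m, a i ≠ b i := fun i hi => hf.ne _ _ (by omega) (by omega) (by omega)
  have ha : ∀ i < m, a i ∈ P := fun i hi => hf.mem _ (by omega)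
  have hb : ∀ i < m, b i ∈ P := fun i hi => hf.mem _ (by omega)
  have hge : ∀ i < m, ∀ z ∈ P, 0 ≤ orient (a i) (b i) z ∧
      (orient (a i) (b i) z = 0 → z = a i ∨ z = b i) := by
    intro i hi z hz
    by_cases h1 : z = a i
    · simp [h1]
    by_cases h2 : z = b i
    · simp [h2]
    have := hedge i hi z hz h1 h2
    exact ⟨this.le, fun h => absurd h this.ne'⟩
  -- The line of each edge is divided into three: the ray beyond `b i` goes to the outer half-plane
  -- `H i`, the open edge to the common set `M`, and the ray before `a i` to the inner region `C`.
  -- Each of the three remains convex and avoids both ends.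
  let H : ℕ → Set Plane := fun i => {z | orient (a i) (b i) z < 0 ∨
    orient (a i) (b i) z = 0 ∧ z ∈ {z | along (a i) (b i) (b i) < along (a i) (b i) z}}
  let M : Set Plane := convexHull ℝ (f '' Set.Iio (2 * m)) ∩
    ⋂ i ∈ Set.Iio m, {z | 0 < orient (a i) (b i) z ∨ orient (a i) (b i) z = 0 ∧
      z ∈ {z | 0 < along (a i) (b i) z} ∩ {z | along (a i) (b i) z < along (a i) (b i) (b i)}}
  let C : Set Plane := ⋂ i ∈ Set.Iio m, {z | 0 < orient (a i) (b i) z ∨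
    orient (a i) (b i) z = 0 ∧ z ∈ {z | along (a i) (b i) z < 0}}
  have hHcov : RegionCov False (⋃ i : Fin m, H i) P m := by
    refine ⟨fun i => H i, fun i => convex_right_union _ _ (convex_along_lt _ _ _), False.elim, ?_⟩
    rw [eq_comm, sdiff_eq_left, Set.disjoint_left]
    intro z hz hzP
    obtain ⟨i, hi⟩ := Set.mem_iUnion.1 hz
    obtain ⟨h1, h2⟩ := hge i i.2 z hzP
    rcases hi with hi | ⟨hi, hi'⟩
    · linarith
    · have hi'' : along (a i) (b i) (b i) < along (a i) (b i) z := hi'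
      rcases h2 hi with rfl | rfl
      · rw [along_self_left] at hi''
        linarith [along_pos (hab i i.2)]
      · exact lt_irrefl _ hi''
  have hMcov : RegionCov False M P 1 := by
    refine regionCov_of_convex _ ((convex_convexHull ℝ _).inter (convex_iInter₂ fun i _ =>
      convex_left_union _ _ ((convex_along_lt _ _ _).inter (convex_along_gt _ _ _)))) ?_
    rintro z ⟨hz, hz'⟩ hzP
    obtain ⟨j, hj, rfl⟩ := hf.exists_index z hzP
    by_cases hjm : 2 * m ≤ j
    · exact hconv j hj hjm hz
    · have := Set.mem_iInter₂.1 hz' (j / 2) (show j / 2 < m by omega)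
      rcases (by omega : j = 2 * (j / 2) ∨ j = 2 * (j / 2) + 1) with h | h
      · have hj : f j = a (j / 2) := congrArg f h
        rw [hj] at this
        rcases this with h | ⟨h, h', h''⟩
        · simp at h
        · simp at h'
      · have hj : f j = b (j / 2) := congrArg f h
        rw [hj] at this
        rcases this with h | ⟨h, h', h''⟩
        · simp at h
        · exact lt_irrefl (along (a (j / 2)) (b (j / 2)) (b (j / 2))) h''
  have hCcov : RegionCov False C P k := by
    refine hk.restrict (convex_iInter₂ fun i _ =>
      convex_left_union _ _ (convex_along_gt _ _ _)) ?_
    intro z hz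
    rw [hQ]
    constructor
    · intro hzP
      obtain ⟨j, hj, rfl⟩ := hf.exists_index z hzP
      refine ⟨j, ?_, hj, rfl⟩
      by_contra hjm
      have := Set.mem_iInter₂.1 hz (j / 2) (show j / 2 < m by omega)
      rcases (by omega : j = 2 * (j / 2) ∨ j = 2 * (j / 2) + 1) with h | h
      · have hj : f j = a (j / 2) := congrArg f h
        rw [hj] at this
        rcases this with h | ⟨h, h'⟩
        · simp at h
        · simp at h'
      · have hj : f j = b (j / 2) := congrArg f h
        rw [hj] at this
        rcases this with h | ⟨h, h'⟩
        · simp at h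
        · have h'' : along (a (j / 2)) (b (j / 2)) (b (j / 2)) < 0 := h'
          linarith [along_pos (hab (j / 2) (by omega))]
    · rintro ⟨j, -, hj, rfl⟩
      exact hf.mem j hj
  refine ((hHcov.union hMcov False.elim).union hCcov False.elim).congr ?_
  ext z
  simp only [Set.mem_sdiff, Set.mem_univ, true_and, and_iff_right_iff_imp, Finset.mem_coe]
  intro hz
  by_cases hzC : z ∈ C
  · exact Or.inr hzC
  left
  obtain ⟨i, hi, hzi⟩ : ∃ i, i < m ∧ ¬ (0 < orient (a i) (b i) z ∨ orient (a i) (b i) z = 0 ∧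
      z ∈ {z | along (a i) (b i) z < 0}) := by
    by_contra! h
    exact hzC (Set.mem_iInter₂.2 fun i hi => by
      have := h i hi
      by_contra hcon
      rcases lt_trichotomy 0 (orient (a i) (b i) z) with h1 | h1 | h1
      · exact hcon (Or.inl h1)
      · exact hcon (by tauto)
      · exact hcon (by tauto))
  rw [not_or] at hzi
  rcases lt_or_eq_of_le (not_lt.1 hzi.1) with h1 | h1
  · exact Or.inl (Set.mem_iUnion.2 ⟨⟨i, hi⟩, Or.inl h1⟩)
  have h2 : 0 ≤ along (a i) (b i) z := not_lt.1 fun h => hzi.2 ⟨h1, h⟩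
  have h3 : along (a i) (b i) z ≠ 0 := by
    intro h
    have : z = a i := frame_ext (hab i hi) (by simp [h1]) (by simp [h])
    exact hz (this ▸ ha i hi)
  have h4 : along (a i) (b i) z ≠ along (a i) (b i) (b i) := by
    intro h
    have : z = b i := frame_ext (hab i hi) (by simp [h1]) h
    exact hz (this ▸ hb i hi)
  rcases lt_or_gt_of_ne h4 with h5 | h5
  swap
  · exact Or.inl (Set.mem_iUnion.2 ⟨⟨i, hi⟩, Or.inr ⟨h1, h5⟩⟩)
  right
  have h2' : 0 < along (a i) (b i) z := lt_of_le_of_ne h2 h3.symm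
  have hD := along_pos (hab i hi)
  set c := along (a i) (b i) z / along (a i) (b i) (b i) with hc
  have hc0 : 0 < c := div_pos h2' hD
  have hc1 : c < 1 := (div_lt_one hD).2 h5
  have hzc : z = (1 - c) • a i + c • b i := by
    refine frame_ext (hab i hi) ?_ ?_
    · rw [orient_comb _ _ _ _ (by ring), h1]; simp
    · rw [along_comb _ _ _ _ (by ring), along_self_left, hc, div_mul_cancel₀ _ hD.ne']; ring
  -- An interior point of edge `i` is strictly inside every other edge `j`, because both ends of
  -- edge `i` are.
  refine ⟨?_, Set.mem_iInter₂.2 fun j hj => ?_⟩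
  · rw [hzc]
    have hai : a i ∈ f '' Set.Iio (2 * m) := ⟨2 * i, by simp; omega, rfl⟩
    have hbi : b i ∈ f '' Set.Iio (2 * m) := ⟨2 * i + 1, by simp; omega, rfl⟩
    exact convex_convexHull ℝ _ (subset_convexHull ℝ _ hai) (subset_convexHull ℝ _ hbi)
      (by linarith) hc0.le (by ring)
  · by_cases hij : j = i
    · subst hij
      exact Or.inr ⟨h1, h2', h5⟩
    · left
      rw [hzc, orient_comb _ _ _ _ (by ring)]
      have hj' : j < m := hj
      have e1 : 0 < orient (a j) (b j) (a i) := hedge j hj _ (ha i hi)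
        (hf.ne _ _ (by omega) (by omega) (by omega)) (hf.ne _ _ (by omega) (by omega) (by omega))
      have e2 : 0 < orient (a j) (b j) (b i) := hedge j hj _ (hb i hi)
        (hf.ne _ _ (by omega) (by omega) (by omega)) (hf.ne _ _ (by omega) (by omega) (by omega))
      have := mul_pos (sub_pos.2 hc1) e1
      have := mul_pos hc0 e2
      linarith

/-- A point with nonnegative barycentric coordinates lies in the triangle. -/
lemma mem_convexHull_of_orient {S : Set Plane} {a b c z : Plane} (ha : a ∈ S) (hb : b ∈ S)
    (hc : c ∈ S) (h : 0 < orient a b c) (h1 : 0 ≤ orient b c z) (h2 : 0 ≤ orient c a z)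
    (h3 : 0 ≤ orient a b z) : z ∈ convexHull ℝ S := by
  have hsum : orient b c z + orient c a z + orient a b z = orient a b c := by
    simp only [orient]; ring
  have hz : z = (orient b c z / orient a b c) • a + (orient c a z / orient a b c) • b +
      (orient a b z / orient a b c) • c := by
    apply plane_ext
    · simp only [PiLp.add_apply, PiLp.smul_apply, smul_eq_mul]
      field_simp
      simp only [orient]; ring
    · simp only [PiLp.add_apply, PiLp.smul_apply, smul_eq_mul]
      field_simp
      simp only [orient]; ring
  have hmem := (convex_convexHull ℝ S).sum_mem (t := (Finset.univ : Finset (Fin 3)))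
    (w := ![orient b c z / orient a b c, orient c a z / orient a b c, orient a b z / orient a b c])
    (z := ![a, b, c]) ?_ ?_ ?_
  · rw [hz]
    simpa [Fin.sum_univ_three] using hmem
  · intro i _
    fin_cases i
    · exact div_nonneg h1 h.le
    · exact div_nonneg h2 h.le
    · exact div_nonneg h3 h.le
  · simp only [Fin.sum_univ_three]
    simp
    rw [← add_div, ← add_div, hsum, div_self h.ne']
  · intro i _
    fin_cases i
    · exact subset_convexHull ℝ S ha
    · exact subset_convexHull ℝ S hb
    · exact subset_convexHull ℝ S hc

/-- In the angular order around a hull vertex, two later points are in counterclockwise position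
with the middle one if the middle one is a hull vertex. -/
lemma GeneralPosition.orient_pos_of_notMem {P : Finset Plane} (hP : GeneralPosition P)
    {v x y z : Plane} (hv : v ∈ P) (hx : x ∈ P) (hy : y ∈ P) (hz : z ∈ P)
    (hxy : 0 < orient v x y) (hyz : 0 < orient v y z) (hxz : 0 < orient v x z)
    (hhull : y ∉ convexHull ℝ ((P : Set Plane) \ {y})) : 0 < orient x y z := by
  have nxy : x ≠ y := by rintro rfl; simp at hxy
  have nyz : y ≠ z := by rintro rfl; simp at hyz
  have nxz : x ≠ z := by rintro rfl; simp at hxz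
  have nvy : v ≠ y := by rintro rfl; simp at hxy
  -- Otherwise `y` lies in the triangle `v x z`.
  by_contra hcon
  have hlt : orient x y z < 0 :=
    lt_of_le_of_ne (not_lt.1 hcon) (hP.orient_ne_zero hx hy hz nxy nxz nyz)
  refine hhull (mem_convexHull_of_orient (a := v) (b := x) (c := z) ⟨hv, nvy⟩ ⟨hx, nxy⟩
    ⟨hz, nyz.symm⟩ hxz ?_ ?_ hxy.le)
  · rw [orient_swap_right]; linarith
  · rw [← orient_rot z v y]
    exact hyz.le

/-- Points in convex position can be listed in counterclockwise order. -/
lemma ConvexPosition.exists_enum {P : Finset Plane} (hP : ConvexPosition P) :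
    ∃ f : ℕ → Plane, IsEnum P f ∧
      ∀ i j k, i < j → j < k → k < P.card → 0 < orient (f i) (f j) (f k) := by
  obtain ⟨f, hf, hpos⟩ := hP.generalPosition.exists_enum
  refine ⟨f, hf, fun i j k hij hjk hk => ?_⟩
  rcases Nat.eq_zero_or_pos i with rfl | hi
  · exact hpos j k hij hjk hk
  · exact hP.generalPosition.orient_pos_of_notMem (hf.mem 0 (by omega)) (hf.mem i (by omega))
      (hf.mem j (by omega)) (hf.mem k hk) (hpos i j hi hij (by omega))
      (hpos j k (by omega) hjk hk) (hpos i k hi (by omega) hk) (hP.notMem (hf.mem j (by omega)))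

/-- The upper bound for points in convex position. -/
theorem ConvexPosition.regionCov_convexBound {P : Finset Plane} (hP : ConvexPosition P) :
    RegionCov False Set.univ P (convexBound P.card) := by
  classical
  -- For these sizes the bound for disjoint sets is the smaller one.
  by_cases hsmall : P.card = 0 ∨ P.card = 1 ∨ P.card = 3
  · refine (hP.generalPosition.regionCov_disjointBound False).mono ?_
    unfold disjointBound convexBound delta
    rcases hsmall with h | h | h <;> simp [h]
  obtain ⟨f, hf, hpos⟩ := hP.exists_enum
  -- Every other edge of the polygon is used; at most one vertex is left over.
  set m := P.card / 2 with hm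
  have hQ : ∃ Q : Finset Plane, (∀ z, z ∈ Q ↔ ∃ j, 2 * m ≤ j ∧ j < P.card ∧ f j = z) ∧
      Q.card ≤ P.card - 2 * m := by
    refine ⟨(Finset.Ico (2 * m) P.card).image f, fun z => by simp [and_assoc], ?_⟩
    exact Finset.card_image_le.trans (by simp)
  obtain ⟨Q, hQ, hQcard⟩ := hQ
  refine (hf.regionCov_matching (m := m) (by omega) ?_ ?_ hQ
    (regionCov_univ_of_card_le_two False (by omega))).mono ?_
  · intro i hi z hz h1 h2
    obtain ⟨j, hj, rfl⟩ := hf.exists_index z hz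
    have hj1 : j ≠ 2 * i := fun h => h1 (by rw [h])
    have hj2 : j ≠ 2 * i + 1 := fun h => h2 (by rw [h])
    rcases Nat.lt_or_gt_of_ne hj1 with h | h
    · rw [orient_rot]
      exact hpos _ _ _ h (by omega) (by omega)
    · exact hpos _ _ _ (by omega) (by omega) hj
  · intro j hj hmj h
    refine hP.notMem (hf.mem j hj) (convexHull_mono ?_ h)
    rintro _ ⟨i, hi, rfl⟩
    have hi' : i < 2 * m := hi
    exact ⟨hf.mem i (by omega), hf.ne _ _ (by omega) hj (by omega)⟩
  · unfold convexBound delta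
    rw [if_neg hsmall]
    omega


/-! ### Crossing hull edges and the bound `7 n / 11 + 4` -/

/-- A discrete intermediate value property: sweeping a threshold over the keys, the number of
upper elements below plus lower elements above takes every intermediate value. -/
lemma exists_card_sweep_eq {α : Type*} [DecidableEq α] (Z : Finset α) (t : α → ℝ)
    (ht : Set.InjOn t Z) (U : α → Prop) [DecidablePred U] (k : ℕ)
    (hD : (Z.filter (fun z => ¬ U z)).card ≤ k) (hU : k + 1 ≤ (Z.filter U).card) :
    ∃ y ∈ Z, (Z.filter (fun z => (U z ∧ t z < t y) ∨ (¬ U z ∧ t y < t z))).card = k := by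
  induction Z using Finset.induction_on_min_value t generalizing k with
  | empty => simp at hU
  | insert a s ha hmin ih =>
    have hlt : ∀ y ∈ s, t a < t y := fun y hy => lt_of_le_of_ne (hmin y hy) fun h =>
      ha (ht (Finset.mem_insert_self a s) (Finset.mem_insert_of_mem hy) h ▸ hy)
    have hs : Set.InjOn t s := ht.mono (by simp)
    by_cases hUa : U a
    · rw [Finset.filter_insert, if_neg (by simpa using hUa)] at hD
      rw [Finset.filter_insert, if_pos hUa, Finset.card_insert_of_notMem (by simp [ha])] at hU
      -- With the threshold at the least key only the lower elements count. If there are fewer than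
      -- `k`, the upper element `a` lies below every later threshold and contributes one, which
      -- leaves `k - 1` for the rest.
      rcases hD.eq_or_lt with hk | hk
      · refine ⟨a, Finset.mem_insert_self a s, ?_⟩
        rw [Finset.filter_insert, if_neg (by simp), ← hk]
        congr 1
        refine Finset.filter_congr fun z hz => ?_
        have := hlt z hz
        constructor
        · rintro (h | h)
          · exact absurd h.2 (lt_asymm this)
          · exact h.1
        · exact fun h => Or.inr ⟨h, this⟩
      · obtain ⟨y, hy, hcard⟩ := ih hs (k - 1) (by omega) (by omega)
        refine ⟨y, Finset.mem_insert_of_mem hy, ?_⟩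
        rw [Finset.filter_insert, if_pos (Or.inl ⟨hUa, hlt y hy⟩),
          Finset.card_insert_of_notMem (by simp [ha]), hcard]
        omega
    · rw [Finset.filter_insert, if_pos (by simpa using hUa),
        Finset.card_insert_of_notMem (by simp [ha])] at hD
      rw [Finset.filter_insert, if_neg hUa] at hU
      obtain ⟨y, hy, hcard⟩ := ih hs k (by omega) hU
      refine ⟨y, Finset.mem_insert_of_mem hy, ?_⟩
      rw [Finset.filter_insert, if_neg, hcard]
      rintro (h | h)
      · exact hUa h.1
      · exact lt_asymm h.2 (hlt y hy)

lemma frame_orient_three (v x a b z : Plane) : along v x x * orient a b z =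
    (along v x b - along v x a) * (orient v x z - orient v x a) -
      (orient v x b - orient v x a) * (along v x z - along v x a) := by
  simp only [along, orient]; ring

/-- If `x` is not a vertex of the convex hull of `P`, some hull edge crosses the line `x y`
properly. -/
lemma GeneralPosition.exists_hullEdge_crossing {P : Finset Plane} (hP : GeneralPosition P)
    {x y : Plane} (hx : x ∈ P) (hy : y ∈ P) (hxy : x ≠ y)
    (hhull : x ∈ convexHull ℝ ((P : Set Plane) \ {x})) :
    ∃ a ∈ P, ∃ b ∈ P, 0 < orient x y a ∧ orient x y b < 0 ∧
      ∀ z ∈ P, z ≠ a → z ≠ b → 0 < orient a b z := by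
  classical
  have hD := along_pos hxy
  set s := along x y with hs
  set o := orient x y with ho
  have hox : o x = 0 := by simp [ho]
  have hoy : o y = 0 := by simp [ho]
  have hsx : s x = 0 := by simp [hs]
  -- The segment from `a` above the line to `b` below it meets the line at coordinate `(s b * o a -
  -- s a * o b) / (o a - o b)`, measured from `x`. If it is never negative, some line through `x`,
  -- given by `τ`, has all other points strictly on one side, and `x` is not in their hull.
  have hneg : ∃ a ∈ P.filter (fun z => 0 < o z), ∃ b ∈ P.filter (fun z => o z < 0),
      s b * o a - s a * o b < 0 := by
    by_contra! hcon
    obtain ⟨τ, hlo, hhi⟩ := Order.exists_between_finsets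
      ((P.filter (fun z => o z < 0)).image (fun z => s z / o z))
      ((P.filter (fun z => 0 < o z)).image (fun z => s z / o z)) (by
        intro u hu v hv
        obtain ⟨b, hb, rfl⟩ := Finset.mem_image.1 hu
        obtain ⟨a, ha, rfl⟩ := Finset.mem_image.1 hv
        have h := hcon a ha b hb
        rw [Finset.mem_filter] at ha hb
        have hne : orient x a b ≠ 0 := by
          refine hP.orient_ne_zero hx ha.1 hb.1 ?_ ?_ ?_
          · rintro rfl; linarith [ha.2]
          · rintro rfl; linarith [hb.2]
          · rintro rfl; linarith [hb.2, ha.2]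
        have h0 := frame_orient x y a b
        have hlt : s a * o b < s b * o a := by
          refine lt_of_le_of_ne (by linarith) fun h' => ?_
          have : along x y y * orient x a b = 0 := by rw [h0]; simp only [← hs, ← ho]; linarith
          exact hne ((mul_eq_zero.1 this).resolve_left hD.ne')
        rw [← neg_div_neg_eq, div_lt_div_iff₀ (by linarith [hb.2]) ha.2]
        linarith)
    have hg : ∀ p q : Plane, ∀ u v : ℝ, u + v = 1 →
        (fun z => s z - τ * o z) (u • p + v • q) =
          u * (fun z => s z - τ * o z) p + v * (fun z => s z - τ * o z) q := by
      intro p q u v huv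
      simp only [hs, ho, along_comb _ _ _ _ huv, orient_comb _ _ _ _ huv]; ring
    have hsub : ((P : Set Plane) \ {x}) ⊆ {z | 0 < (fun z => s z - τ * o z) z} := by
      rintro z ⟨hz, hzx⟩
      rw [Set.mem_singleton_iff] at hzx
      show 0 < s z - τ * o z
      rcases lt_trichotomy (o z) 0 with h | h | h
      · have := hlo _ (Finset.mem_image_of_mem _ (Finset.mem_filter.2 ⟨hz, h⟩))
        rw [div_lt_iff_of_neg h] at this
        linarith
      · by_cases hzy : z = y
        · rw [hzy, hoy]; simpa using hD
        · exact absurd h (hP.orient_ne_zero hx hy hz hxy (Ne.symm hzx) (Ne.symm hzy))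
      · have := hhi _ (Finset.mem_image_of_mem _ (Finset.mem_filter.2 ⟨hz, h⟩))
        rw [lt_div_iff₀ h] at this
        linarith
    have := convexHull_min hsub (convex_of_affine_lt hg 0) hhull
    have h' : 0 < s x - τ * o x := this
    rw [hsx, hox] at h'
    simp at h'
  obtain ⟨a₀, ha₀, b₀, hb₀, hneg⟩ := hneg
  -- The segment that crosses farthest behind `x` is a hull edge: a point on its wrong side, joined
  -- to `a` or `b`, would cross still farther behind.
  obtain ⟨⟨a, b⟩, hab, hmin⟩ :=
    ((P.filter (fun z => 0 < o z)) ×ˢ (P.filter (fun z => o z < 0))).exists_min_image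
      (fun p => (s p.2 * o p.1 - s p.1 * o p.2) / (o p.1 - o p.2))
      ⟨(a₀, b₀), Finset.mem_product.2 ⟨ha₀, hb₀⟩⟩
  have h0 := hmin (a₀, b₀) (Finset.mem_product.2 ⟨ha₀, hb₀⟩)
  rw [Finset.mem_product, Finset.mem_filter, Finset.mem_filter] at hab
  obtain ⟨⟨haP, hoa⟩, hbP, hob⟩ := hab
  dsimp only at haP hoa hbP hob h0
  have hN : s b * o a - s a * o b < 0 := by
    have h1 : (s b₀ * o a₀ - s a₀ * o b₀) / (o a₀ - o b₀) < 0 :=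
      div_neg_of_neg_of_pos hneg (by linarith [(Finset.mem_filter.1 ha₀).2,
        (Finset.mem_filter.1 hb₀).2])
    have h2 := h0.trans_lt h1
    rwa [div_lt_iff₀ (by linarith), zero_mul] at h2
  refine ⟨a, haP, b, hbP, hoa, hob, fun z hz hza hzb => ?_⟩
  have hne : orient a b z ≠ 0 := by
    refine hP.orient_ne_zero haP hbP hz ?_ hza.symm hzb.symm
    rintro rfl; linarith
  have hE := frame_orient_three x y a b z
  rw [← hs, ← ho] at hE
  refine lt_of_le_of_ne (nonneg_of_mul_nonneg_right (a := s y) ?_ hD) hne.symm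
  rw [hE]
  rcases lt_trichotomy (o z) 0 with h | h | h
  · have h1 := hmin (a, z) (Finset.mem_product.2 ⟨Finset.mem_filter.2 ⟨haP, hoa⟩,
      Finset.mem_filter.2 ⟨hz, h⟩⟩)
    dsimp only at h1
    rw [div_le_div_iff₀ (by linarith) (by linarith)] at h1
    refine nonneg_of_mul_nonneg_right (a := o a) ?_ hoa
    nlinarith
  · by_cases hzx : z = x
    · rw [hzx, hox, hsx]; nlinarith
    by_cases hzy : z = y
    · rw [hzy, hoy]
      nlinarith [mul_pos (sub_pos.2 (hob.trans hoa)) hD]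
    exact absurd h (hP.orient_ne_zero hx hy hz hxy (Ne.symm hzx) (Ne.symm hzy))
  · have h1 := hmin (z, b) (Finset.mem_product.2 ⟨Finset.mem_filter.2 ⟨hz, h⟩,
      Finset.mem_filter.2 ⟨hbP, hob⟩⟩)
    dsimp only at h1
    rw [div_le_div_iff₀ (by linarith) (by linarith)] at h1
    refine nonneg_of_mul_nonneg_right (a := -o b) ?_ (by linarith)
    nlinarith

/-- Cutting along a hull edge `p q` and the line `x y`, where `S₁` and `S₂` contain the two outer
parts of the line `p q`. -/
lemma GeneralPosition.regionCov_of_outer_parts {P : Finset Plane} (hP : GeneralPosition P)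
    {p q x y : Plane} (hp : p ∈ P) (hq : q ∈ P) (hpq : p ≠ q) (hx : x ∈ P) (hy : y ∈ P)
    (hxy : x ≠ y) (hedge : ∀ z ∈ P, z ≠ p → z ≠ q → 0 < orient p q z)
    (hxp : orient x y p ≠ 0) (hxq : orient x y q ≠ 0)
    {S₁ S₂ : Set Plane} (hS₁ : Convex ℝ S₁) (hS₂ : Convex ℝ S₂)
    (hp₁ : p ∉ S₁) (hq₁ : q ∉ S₁) (hp₂ : p ∉ S₂) (hq₂ : q ∉ S₂)
    (hout : ∀ z, orient p q z = 0 → along p q z < 0 ∨ along p q q < along p q z →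
      z ∈ S₁ ∧ 0 < orient x y z ∨ z ∈ S₂ ∧ orient x y z < 0)
    {L R : Finset Plane} (hL : ∀ f, f ∈ L ↔ (f ∈ P ∧ f ≠ p ∧ f ≠ q) ∧ 0 < orient x y f)
    (hR : ∀ f, f ∈ R ↔ (f ∈ P ∧ f ≠ p ∧ f ≠ q) ∧ orient x y f < 0)
    (hne : L.Nonempty) {m k : ℕ} (hm : ∀ e ∈ L, RegionCov False Set.univ (L.erase e) m)
    (hk : RegionCov False Set.univ R k) : RegionCov False Set.univ P (1 + (m + 1) + k) := by
  classical
  have hxp' : x ≠ p := by rintro rfl; simp at hxp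
  have hxq' : x ≠ q := by rintro rfl; simp at hxq
  have hyp' : y ≠ p := by rintro rfl; simp at hxp
  have hyq' : y ≠ q := by rintro rfl; simp at hxq
  set P' := (P.erase p).erase q with hP'
  have hmem' : ∀ z, z ∈ P' ↔ z ∈ P ∧ z ≠ p ∧ z ≠ q := by
    intro z; simp only [hP', Finset.mem_erase]; tauto
  have hPP' : GeneralPosition P' := hP.mono fun z hz => ((hmem' z).1 hz).1
  -- The inner half-plane of `p q` with both outer rays is not convex. Here the part left of `x y`
  -- takes one ray and the part right of it the other, so each stays convex and avoids `p` and `q`.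
  let C₁ : Set Plane := {z | 0 < orient p q z ∨ orient p q z = 0 ∧ z ∈ S₁}
  let C₂ : Set Plane := {z | 0 < orient p q z ∨ orient p q z = 0 ∧ z ∈ S₂}
  have hC₁ : Convex ℝ C₁ := convex_left_union p q hS₁
  have hC₂ : Convex ℝ C₂ := convex_left_union p q hS₂
  have hC₁P : ∀ z ∈ C₁, z ∈ P ↔ z ∈ P' := by
    intro z hz
    rw [hmem']
    refine ⟨fun h => ⟨h, ?_, ?_⟩, fun h => h.1⟩
    · rintro rfl
      rcases hz with h | h
      · simp at h
      · exact hp₁ h.2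
    · rintro rfl
      rcases hz with h | h
      · simp at h
      · exact hq₁ h.2
  have hC₂P : ∀ z ∈ C₂, z ∈ P ↔ z ∈ P' := by
    intro z hz
    rw [hmem']
    refine ⟨fun h => ⟨h, ?_, ?_⟩, fun h => h.1⟩
    · rintro rfl
      rcases hz with h | h
      · simp at h
      · exact hp₂ h.2
    · rintro rfl
      rcases hz with h | h
      · simp at h
      · exact hq₂ h.2
  have hUcov : RegionCov False (rightRegion p q) P 1 := by
    refine regionCov_of_convex _ (convex_rightRegion p q) ?_
    intro z hz hzP
    by_cases hzp : z = p
    · subst hzp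
      rcases hz with h | ⟨-, h, -⟩ <;> simp at h
    by_cases hzq : z = q
    · subst hzq
      rcases hz with h | ⟨-, -, h⟩ <;> simp at h
    have := hedge z hzP hzp hzq
    rcases hz with h | ⟨h, -⟩ <;> linarith
  have hx' : x ∈ P' := (hmem' x).2 ⟨hx, hxp', hxq'⟩
  have hy' : y ∈ P' := (hmem' y).2 ⟨hy, hyp', hyq'⟩
  have hLcov : RegionCov False (leftRegion x y ∩ C₁) P (m + 1) := by
    refine ((regionCov_leftRegion hPP' hx' hy' hxy (L := L) (fun f => by rw [hL, hmem'])
      hne hm).inter hC₁).congr ?_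
    ext z
    simp only [Set.mem_sdiff, Set.mem_inter_iff, Finset.mem_coe]
    exact and_congr_right fun h => not_congr (hC₁P z h.2).symm
  have hRcov : RegionCov False (rightRegion x y ∩ C₂) P k := by
    refine hk.restrict ((convex_rightRegion x y).inter hC₂) ?_
    rintro z ⟨h1, h2⟩
    rw [hC₂P z h2, hR, ← hmem']
    refine ⟨fun h => ⟨h, ?_⟩, fun h => h.1⟩
    rcases h1 with h1 | ⟨h1, h3, h4⟩
    · exact h1
    · have hzx : z ≠ x := by rintro rfl; simp at h3
      have hzy : z ≠ y := by rintro rfl; simp at h4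
      exact absurd h1 (hPP'.orient_ne_zero hx' hy' h hxy hzx.symm hzy.symm)
  refine ((hUcov.union hLcov False.elim).union hRcov False.elim).congr ?_
  ext z
  simp only [Set.mem_sdiff, Set.mem_univ, true_and, and_iff_right_iff_imp, Finset.mem_coe]
  intro hz
  have hz' : ∀ w ∈ P, z ≠ w := fun w hw h => hz (h ▸ hw)
  rcases mem_leftRegion_or_rightRegion hpq (hz' p hp) (hz' q hq) with h | h
  swap
  · exact Or.inl (Or.inl h)
  rcases h with h | ⟨h, h2⟩
  · rcases mem_leftRegion_or_rightRegion hxy (hz' x hx) (hz' y hy) with h' | h'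
    · exact Or.inl (Or.inr ⟨h', Or.inl h⟩)
    · exact Or.inr ⟨h', Or.inl h⟩
  · rcases hout z h h2 with ⟨h3, h4⟩ | ⟨h3, h4⟩
    · exact Or.inl (Or.inr ⟨Or.inl h4, Or.inr ⟨h, h3⟩⟩)
    · exact Or.inr ⟨Or.inl h4, Or.inr ⟨h, h3⟩⟩

/-- Cutting along a hull edge `p q` and a line `x y` that crosses it. -/
lemma GeneralPosition.regionCov_crossing {P : Finset Plane} (hP : GeneralPosition P)
    {p q x y : Plane} (hp : p ∈ P) (hq : q ∈ P) (hx : x ∈ P) (hy : y ∈ P)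
    (hxy : x ≠ y) (hedge : ∀ z ∈ P, z ≠ p → z ≠ q → 0 < orient p q z)
    (hcross : orient x y p * orient x y q < 0)
    {L R : Finset Plane} (hL : ∀ f, f ∈ L ↔ (f ∈ P ∧ f ≠ p ∧ f ≠ q) ∧ 0 < orient x y f)
    (hR : ∀ f, f ∈ R ↔ (f ∈ P ∧ f ≠ p ∧ f ≠ q) ∧ orient x y f < 0)
    (hne : L.Nonempty) {m k : ℕ} (hm : ∀ e ∈ L, RegionCov False Set.univ (L.erase e) m)
    (hk : RegionCov False Set.univ R k) : RegionCov False Set.univ P (1 + (m + 1) + k) := by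
  have hxp : orient x y p ≠ 0 := by rintro h; simp [h] at hcross
  have hxq : orient x y q ≠ 0 := by rintro h; simp [h] at hcross
  have hpq : p ≠ q := by rintro rfl; nlinarith [mul_self_nonneg (orient x y p)]
  have hD := along_pos hpq
  -- On the line `p q` the side of `x y` is interpolated from the values at `p` and `q`. These have
  -- opposite signs, so the two outer rays lie on opposite sides of `x y`.
  have hline : ∀ z, orient p q z = 0 → along p q q * orient x y z =
      (along p q q - along p q z) * orient x y p + along p q z * orient x y q := by
    intro z hz
    have hzc : z = (1 - along p q z / along p q q) • p + (along p q z / along p q q) • q := by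
      refine frame_ext hpq ?_ ?_
      · rw [orient_comb _ _ _ _ (by ring), hz]; simp
      · rw [along_comb _ _ _ _ (by ring), along_self_left, div_mul_cancel₀ _ hD.ne']; ring
    conv_lhs => rw [hzc]
    rw [orient_comb _ _ _ _ (by ring)]
    field_simp
  have h1 : p ∉ {z | along p q z < 0} := by simp
  have h2 : q ∉ {z | along p q z < 0} := fun h => lt_asymm hD h
  have h3 : p ∉ {z | along p q q < along p q z} := by simpa using hD.le
  have h4 : q ∉ {z | along p q q < along p q z} := by simp
  rcases lt_or_gt_of_ne hxp with hpn | hpp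
  · have hqp : 0 < orient x y q := by
      by_contra h
      nlinarith [mul_nonneg_of_nonpos_of_nonpos hpn.le (not_lt.1 h)]
    refine hP.regionCov_of_outer_parts hp hq hpq hx hy hxy hedge hxp hxq
      (convex_along_lt p q _) (convex_along_gt p q 0) h3 h4 h1 h2 ?_ hL hR hne hm hk
    rintro z hz (h | h)
    · refine Or.inr ⟨h, ?_⟩
      have e : along p q q * orient x y z < 0 := by
        rw [hline z hz]
        nlinarith [mul_neg_of_pos_of_neg (by linarith : 0 < along p q q - along p q z) hpn,
          mul_neg_of_neg_of_pos h hqp]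
      exact (pos_iff_neg_of_mul_neg e).1 hD
    · refine Or.inl ⟨h, ?_⟩
      have e : 0 < along p q q * orient x y z := by
        rw [hline z hz]
        nlinarith [mul_pos_of_neg_of_neg (by linarith : along p q q - along p q z < 0) hpn,
          mul_pos (hD.trans h) hqp]
      exact pos_of_mul_pos_right e hD.le
  · have hqn : orient x y q < 0 := (pos_iff_neg_of_mul_neg hcross).1 hpp
    refine hP.regionCov_of_outer_parts hp hq hpq hx hy hxy hedge hxp hxq
      (convex_along_gt p q 0) (convex_along_lt p q _) h1 h2 h3 h4 ?_ hL hR hne hm hk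
    rintro z hz (h | h)
    · refine Or.inl ⟨h, ?_⟩
      have e : 0 < along p q q * orient x y z := by
        rw [hline z hz]
        nlinarith [mul_pos (by linarith : 0 < along p q q - along p q z) hpp,
          mul_pos_of_neg_of_neg h hqn]
      exact pos_of_mul_pos_right e hD.le
    · refine Or.inr ⟨h, ?_⟩
      have e : along p q q * orient x y z < 0 := by
        rw [hline z hz]
        nlinarith [mul_neg_of_neg_of_pos (by linarith : along p q q - along p q z < 0) hpp,
          mul_neg_of_pos_of_neg (hD.trans h) hqn]
      exact (pos_iff_neg_of_mul_neg e).1 hD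


/-- Rotating a line around a point `x` of `P`, starting from a line with at most seven points on
one side, one finds a point `y` such that the line `x y` has exactly eight points on one side. -/
lemma GeneralPosition.exists_card_side_eq_eight {P : Finset Plane} (hP : GeneralPosition P)
    {v x : Plane} (hv : v ∈ P) (hx : x ∈ P) (hvx : v ≠ x)
    (hcard : 17 ≤ P.card) (hfew : (P.filter (fun z => orient v x z < 0)).card ≤ 7) :
    ∃ y ∈ P, y ≠ x ∧ ((P.filter (fun z => 0 < orient x y z)).card = 8 ∨
      (P.filter (fun z => orient x y z < 0)).card = 8) := by
  classical
  have hD := along_pos hvx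
  set Z := (P.erase x).erase v with hZ
  have hmem : ∀ z, z ∈ Z ↔ z ∈ P ∧ z ≠ x ∧ z ≠ v := by
    intro z; simp only [hZ, Finset.mem_erase]; tauto
  have hZcard : Z.card + 2 = P.card := by
    have h1 := Finset.card_erase_add_one hx
    have h2 := Finset.card_erase_add_one (s := P.erase x) (a := v)
      (Finset.mem_erase.2 ⟨hvx, hv⟩)
    rw [hZ]
    omega
  set h : Plane → ℝ := orient v x with hh
  have hne : ∀ z ∈ Z, h z ≠ 0 := fun z hz => by
    obtain ⟨h1, h2, h3⟩ := (hmem z).1 hz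
    exact hP.orient_ne_zero hv hx h1 hvx h3.symm h2.symm
  -- The cotangent of the direction from `x`, relative to the line `v x`. Together with the signs of
  -- `h` it decides the side of `x y`, as `hkey` states.
  set t : Plane → ℝ := fun z => (along v x z - along v x x) / h z with ht
  have hkey : ∀ y ∈ Z, ∀ z ∈ Z, along v x x * orient x y z = h y * h z * (t y - t z) := by
    intro y hy z hz
    have h1 := frame_orient_three v x x y z
    have h2 := hne y hy
    have h3 := hne z hz
    rw [h1, orient_self_right]
    simp only [ht, ← hh]
    field_simp
    ring
  have hinj : Set.InjOn t Z := by
    intro y hy z hz hyz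
    by_contra hne'
    have h1 := hkey y hy z hz
    rw [hyz, sub_self, mul_zero] at h1
    obtain ⟨a1, a2, a3⟩ := (hmem y).1 hy
    obtain ⟨b1, b2, b3⟩ := (hmem z).1 hz
    exact hP.orient_ne_zero hx a1 b1 a2.symm b2.symm hne'
      ((mul_eq_zero.1 h1).resolve_left hD.ne')
  have hDcard : (Z.filter (fun z => ¬ 0 < h z)).card ≤ 7 := by
    refine le_trans (Finset.card_le_card ?_) hfew
    intro z hz
    rw [Finset.mem_filter] at hz ⊢
    exact ⟨((hmem z).1 hz.1).1, lt_of_le_of_ne (not_lt.1 hz.2) (hne z hz.1)⟩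
  have hUcard : 7 + 1 ≤ (Z.filter (fun z => 0 < h z)).card := by
    have := Finset.card_filter_add_card_filter_not (s := Z) (fun z => 0 < h z)
    omega
  -- Seven and not eight, because `v` falls on the same side of `x y` as the counted points. At
  -- least 15 points besides `v` and `x`, with at most seven below, leave eight above.
  obtain ⟨y, hy, hycard⟩ := exists_card_sweep_eq Z t hinj (fun z => 0 < h z) 7 hDcard hUcard
  obtain ⟨hyP, hyx, hyv⟩ := (hmem y).1 hy
  refine ⟨y, hyP, hyx, ?_⟩
  have hv0 : orient x y v = h y := orient_rot v x y
  set W := Z.filter (fun z => (0 < h z ∧ t z < t y) ∨ (¬ 0 < h z ∧ t y < t z)) with hW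
  have hvW : v ∉ W := by
    rw [hW, Finset.mem_filter, hmem]; tauto
  have hWcard : (insert v W).card = 8 := by rw [Finset.card_insert_of_notMem hvW, hycard]
  have hWiff : ∀ z ∈ Z, z ∈ W ↔ 0 < h z * (t y - t z) := by
    intro z hz
    rw [hW, Finset.mem_filter]
    rcases lt_or_gt_of_ne (hne z hz) with h1 | h1
    · rw [mul_pos_iff]
      constructor
      · rintro ⟨-, h2 | h2⟩
        · linarith [h2.1]
        · exact Or.inr ⟨h1, by linarith [h2.2]⟩
      · rintro (h2 | h2)
        · linarith [h2.1]
        · exact ⟨hz, Or.inr ⟨not_lt.2 h1.le, by linarith [h2.2]⟩⟩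
    · rw [mul_pos_iff]
      constructor
      · rintro ⟨-, h2 | h2⟩
        · exact Or.inl ⟨h1, by linarith [h2.2]⟩
        · exact absurd h1 h2.1
      · rintro (h2 | h2)
        · exact ⟨hz, Or.inl ⟨h1, by linarith [h2.2]⟩⟩
        · linarith [h2.1]
  rcases lt_or_gt_of_ne (hne y hy) with hyn | hyp
  · right
    rw [← hWcard]
    congr 1
    ext z
    rw [Finset.mem_filter, Finset.mem_insert]
    by_cases hzv : z = v
    · subst hzv
      rw [hv0]; tauto
    by_cases hzx : z = x
    · subst hzx
      simp [hzv, hW, hmem]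
    constructor
    · rintro ⟨hz, hlt⟩
      have hzZ := (hmem z).2 ⟨hz, hzx, hzv⟩
      refine Or.inr ((hWiff z hzZ).2 ?_)
      have h1 := hkey y hy z hzZ
      have h2 := mul_neg_of_pos_of_neg hD hlt
      rw [h1, mul_assoc] at h2
      exact (neg_iff_pos_of_mul_neg h2).1 hyn
    · rintro (h1 | h1)
      · exact absurd h1 hzv
      · have hzZ : z ∈ Z := (Finset.mem_filter.1 h1).1
        refine ⟨((hmem z).1 hzZ).1, ?_⟩
        have h2 := mul_neg_of_neg_of_pos hyn ((hWiff z hzZ).1 h1)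
        rw [← mul_assoc, ← hkey y hy z hzZ] at h2
        exact (pos_iff_neg_of_mul_neg h2).1 hD
  · left
    rw [← hWcard]
    congr 1
    ext z
    rw [Finset.mem_filter, Finset.mem_insert]
    by_cases hzv : z = v
    · subst hzv
      rw [hv0]; tauto
    by_cases hzx : z = x
    · subst hzx
      simp [hzv, hW, hmem]
    constructor
    · rintro ⟨hz, hlt⟩
      have hzZ := (hmem z).2 ⟨hz, hzx, hzv⟩
      refine Or.inr ((hWiff z hzZ).2 ?_)
      have h1 := hkey y hy z hzZ
      have h2 := mul_pos hD hlt
      rw [h1, mul_assoc] at h2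
      exact pos_of_mul_pos_right h2 hyp.le
    · rintro (h1 | h1)
      · exact absurd h1 hzv
      · have hzZ : z ∈ Z := (Finset.mem_filter.1 h1).1
        refine ⟨((hmem z).1 hzZ).1, ?_⟩
        have h2 := mul_pos hyp ((hWiff z hzZ).1 h1)
        rw [← mul_assoc, ← hkey y hy z hzZ] at h2
        exact pos_of_mul_pos_right h2 hD.le

/-- A line `x y` with eight points on its left that is crossed properly by a hull edge allows one
to remove eleven points at the cost of seven sets. -/
lemma GeneralPosition.regionCov_of_card_left_eq_eight {P : Finset Plane} (hP : GeneralPosition P)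
    {p q x y : Plane} (hp : p ∈ P) (hq : q ∈ P) (hx : x ∈ P) (hy : y ∈ P)
    (hxy : x ≠ y) (hedge : ∀ z ∈ P, z ≠ p → z ≠ q → 0 < orient p q z)
    (hcross : orient x y p * orient x y q < 0)
    (h8 : (P.filter (fun z => 0 < orient x y z)).card = 8) {k : ℕ}
    (ih : ∀ R ⊆ P, R.card + 11 = P.card → RegionCov False Set.univ R k) :
    RegionCov False Set.univ P (7 + k) := by
  classical
  set L := (((P.erase p).erase q).filter (fun z => 0 < orient x y z)) with hL
  set R := (((P.erase p).erase q).filter (fun z => orient x y z < 0)) with hR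
  have hsplit : (P.filter (fun z => 0 < orient x y z)).card +
      (P.filter (fun z => orient x y z < 0)).card + 2 = P.card := by
    have h1 := Finset.card_filter_add_card_filter_not (s := P) (fun z => 0 < orient x y z)
    have h2 : P.filter (fun z => ¬ 0 < orient x y z) =
        insert x (insert y (P.filter (fun z => orient x y z < 0))) := by
      ext z
      simp only [Finset.mem_filter, Finset.mem_insert]
      constructor
      · rintro ⟨hz, h⟩
        by_cases hzx : z = x
        · exact Or.inl hzx
        by_cases hzy : z = y
        · exact Or.inr (Or.inl hzy)
        exact Or.inr (Or.inr ⟨hz, lt_of_le_of_ne (not_lt.1 h)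
          (hP.orient_ne_zero hx hy hz hxy (Ne.symm hzx) (Ne.symm hzy))⟩)
      · rintro (rfl | rfl | h)
        · simp [hx]
        · simp [hy]
        · exact ⟨h.1, not_lt.2 h.2.le⟩
    rw [h2, Finset.card_insert_of_notMem (by simp [hxy]),
      Finset.card_insert_of_notMem (by simp)] at h1
    omega
  have hcards : L.card = 7 ∧ R.card + 1 = (P.filter (fun z => orient x y z < 0)).card := by
    rw [hL, hR, Finset.filter_erase, Finset.filter_erase, Finset.filter_erase,
      Finset.filter_erase]
    rcases mul_neg_iff.1 hcross with ⟨h1, h2⟩ | ⟨h1, h2⟩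
    · constructor
      · rw [Finset.erase_eq_of_notMem (a := q), Finset.card_erase_of_mem, h8]
        · exact Finset.mem_filter.2 ⟨hp, h1⟩
        · simp only [Finset.mem_erase, Finset.mem_filter]
          rintro ⟨-, -, h⟩; linarith
      · rw [Finset.erase_eq_of_notMem (a := p), Finset.card_erase_add_one]
        · exact Finset.mem_filter.2 ⟨hq, h2⟩
        · simp only [Finset.mem_filter]
          rintro ⟨-, h⟩; linarith
    · constructor
      · rw [Finset.erase_eq_of_notMem (a := p), Finset.card_erase_of_mem, h8]
        · exact Finset.mem_filter.2 ⟨hq, h2⟩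
        · simp only [Finset.mem_filter]
          rintro ⟨-, h⟩; linarith
      · rw [Finset.erase_eq_of_notMem (a := q), Finset.card_erase_add_one]
        · exact Finset.mem_filter.2 ⟨hp, h1⟩
        · simp only [Finset.mem_erase, Finset.mem_filter]
          rintro ⟨-, -, h⟩; linarith
  have hsubR : R ⊆ P := fun z hz =>
    Finset.mem_of_mem_erase (Finset.mem_of_mem_erase (Finset.mem_filter.1 hz).1)
  have hsubL : L ⊆ P := fun z hz =>
    Finset.mem_of_mem_erase (Finset.mem_of_mem_erase (Finset.mem_filter.1 hz).1)
  -- One end of the hull edge is among the eight points on the left. Of the remaining seven the cut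
  -- drops one more, and six points need `disjointBound 6 = 5` sets. With the cut and the outer
  -- half-plane of `p q` this makes seven sets, for the eight points, `x`, `y` and the other end of
  -- the edge.
  refine (hP.regionCov_crossing hp hq hx hy hxy hedge hcross (L := L) (R := R) ?_ ?_ ?_ (m := 5)
    ?_ (ih R hsubR (by omega))).mono (by omega)
  · intro z
    simp only [hL, Finset.mem_filter, Finset.mem_erase]; tauto
  · intro z
    simp only [hR, Finset.mem_filter, Finset.mem_erase]; tauto
  · rw [← Finset.card_pos]; omega
  · intro e he
    refine ((hP.mono ((Finset.erase_subset e L).trans hsubL)).regionCov_disjointBound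
      False).mono ?_
    rw [Finset.card_erase_of_mem he, hcards.1]
    decide

/-- The upper bound for covers by arbitrary convex sets in general position. -/
theorem GeneralPosition.regionCov_sevenElevenths {P : Finset Plane} (hP : GeneralPosition P) :
    RegionCov False Set.univ P ((7 * P.card + 44) / 11) := by
  classical
  induction hn : P.card using Nat.strong_induction_on generalizing P with
  | _ n ih =>
  subst hn
  -- The bound for disjoint sets is good enough up to 77 points, and the argument below needs only
  -- 17; the threshold is not critical.
  by_cases hsmall : P.card < 39
  · refine (hP.regionCov_disjointBound False).mono ?_
    unfold disjointBound
    omega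
  obtain ⟨f, hf, hpos⟩ := hP.exists_enum
  -- If `f 0`, …, `f 7` are all hull vertices, four hull edges remove eight points with five sets,
  -- and `5 / 8 < 7 / 11`.
  by_cases hall : ∀ i, 1 ≤ i → i < 8 → f i ∉ convexHull ℝ ((P : Set Plane) \ {f i})
  · have hord : ∀ i j k, i < j → j < k → j < 8 → k < P.card → 0 < orient (f i) (f j) (f k) := by
      intro i j k hij hjk hj hk
      rcases Nat.eq_zero_or_pos i with rfl | hi
      · exact hpos j k hij hjk hk
      · exact hP.orient_pos_of_notMem (hf.mem 0 (by omega)) (hf.mem i (by omega))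
          (hf.mem j (by omega)) (hf.mem k hk) (hpos i j hi hij (by omega))
          (hpos j k (by omega) hjk hk) (hpos i k hi (by omega) hk) (hall j (by omega) hj)
    set Q := (Finset.Ico 8 P.card).image f with hQ
    have hQcard : Q.card = P.card - 8 := by
      rw [hQ, Finset.card_image_of_injOn, Nat.card_Ico]
      intro i hi j hj hij
      rw [Finset.mem_coe, Finset.mem_Ico] at hi hj
      by_contra hne
      exact hf.ne i j hi.2 hj.2 hne hij
    have hQP : Q ⊆ P := by
      intro z hz
      obtain ⟨j, hj, rfl⟩ := Finset.mem_image.1 hz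
      exact hf.mem j (Finset.mem_Ico.1 hj).2
    refine (hf.regionCov_matching (m := 4) (by omega) ?_ ?_ (Q := Q) (by
      intro z; simp [hQ, and_assoc]) (ih Q.card (by omega) (hP.mono hQP) rfl)).mono ?_
    · intro i hi z hz h1 h2
      obtain ⟨j, hj, rfl⟩ := hf.exists_index z hz
      have hj1 : j ≠ 2 * i := fun h => h1 (by rw [h])
      have hj2 : j ≠ 2 * i + 1 := fun h => h2 (by rw [h])
      rcases Nat.lt_or_gt_of_ne hj1 with h | h
      · rw [orient_rot]
        exact hord _ _ _ h (by omega) (by omega) (by omega)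
      · exact hord _ _ _ (by omega) (by omega) (by omega) hj
    · intro j hj hmj h
      -- The line `f 0 f 7` separates the eight points from the later ones.
      have hsub : f '' Set.Iio (2 * 4) ⊆ {z | 0 < orient (f 0) (f 7) z ∨
          orient (f 0) (f 7) z = 0 ∧ z ∈ (∅ : Set Plane)}ᶜ := by
        rintro _ ⟨i, hi, rfl⟩
        have hi' : i < 2 * 4 := hi
        rintro (h | h)
        · rcases (by omega : i = 0 ∨ i = 7 ∨ (0 < i ∧ i < 7)) with rfl | rfl | h'
          · simp at h
          · simp at h
          · have := hpos i 7 h'.1 h'.2 (by omega)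
            rw [orient_swap_right] at this
            linarith
        · exact h.2
      have hconv : Convex ℝ {z : Plane | 0 < orient (f 0) (f 7) z ∨
          orient (f 0) (f 7) z = 0 ∧ z ∈ (∅ : Set Plane)}ᶜ := by
        have := convex_right_union (f 0) (f 7) convex_univ
        convert this using 1
        ext z
        simp only [Set.mem_compl_iff, Set.mem_ofPred_eq, Set.mem_empty_iff_false, and_false,
          or_false, not_lt, Set.mem_univ, and_true]
        exact le_iff_lt_or_eq
      exact convexHull_min hsub hconv h (Or.inl (hpos 7 j (by omega) (by omega) hj))
    · rw [hQcard]; omega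
  · push Not at hall
    obtain ⟨i, hi1, hi8, hhull⟩ := hall
    have hx := hf.mem i (by omega)
    have hv := hf.mem 0 (by omega)
    -- Right of the line `f 0 f i` there are only points of index below `i`, so at most seven.
    obtain ⟨y, hy, hyx, h8⟩ := hP.exists_card_side_eq_eight hv hx
      (hf.ne 0 i (by omega) (by omega) (by omega)) (by omega) (by
        have hsub : P.filter (fun z => orient (f 0) (f i) z < 0) ⊆ (Finset.range i).image f := by
          intro z hz
          obtain ⟨hz, hlt⟩ := Finset.mem_filter.1 hz
          obtain ⟨j, hj, rfl⟩ := hf.exists_index z hz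
          refine Finset.mem_image_of_mem f (Finset.mem_range.2 ?_)
          by_contra hij
          rcases (by omega : j = i ∨ i < j) with rfl | h
          · simp at hlt
          · have := hpos i j (by omega) h hj
            linarith
        refine (Finset.card_le_card hsub).trans (Finset.card_image_le.trans ?_)
        rw [Finset.card_range]; omega)
    obtain ⟨a, ha, b, hb, hoa, hob, hedge⟩ := hP.exists_hullEdge_crossing hx hy hyx.symm hhull
    have hrest : ∀ R ⊆ P, R.card + 11 = P.card →
        RegionCov False Set.univ R ((7 * (P.card - 11) + 44) / 11) := by
      intro R hR hc
      have := ih R.card (by omega) (hP.mono hR) rfl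
      rwa [show R.card = P.card - 11 by omega] at this
    rcases h8 with h8 | h8
    · exact (hP.regionCov_of_card_left_eq_eight ha hb hx hy hyx.symm hedge
        (mul_neg_of_pos_of_neg hoa hob) h8 hrest).mono (by omega)
    · refine (hP.regionCov_of_card_left_eq_eight ha hb hy hx hyx hedge ?_ ?_ hrest).mono (by omega)
      · rw [orient_swap, orient_swap _ _ b]
        nlinarith [mul_neg_of_pos_of_neg hoa hob]
      · rw [← h8]
        congr 1
        ext z
        rw [Finset.mem_filter, Finset.mem_filter, orient_swap, neg_pos]


/-! ### Noncrossing colourings -/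

/-- No two colours alternate on four points of `E` in their linear order. -/
def NonCrossing {α : Type*} (E : Finset ℕ) (H : ℕ → α → Prop) : Prop :=
  ∀ a ∈ E, ∀ b ∈ E, ∀ c ∈ E, ∀ d ∈ E, a < b → b < c → c < d →
    ∀ u w, H a u → H c u → H b w → H d w → u = w

lemma NonCrossing.mono {α : Type*} {E F : Finset ℕ} {H : ℕ → α → Prop} (h : NonCrossing E H)
    (hF : F ⊆ E) : NonCrossing F H :=
  fun a ha b hb c hc d hd => h a (hF ha) b (hF hb) c (hF hc) d (hF hd)

/-- The two sides differ exactly when `a`, `c` and `b`, `d` alternate cyclically. That happens in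
eight linear orders, and each is forbidden. Stated as an equivalence, the condition turns later
arguments into case checks on the order. -/
lemma NonCrossing.between_iff {α : Type*} {E : Finset ℕ} {H : ℕ → α → Prop}
    (h : NonCrossing E H) {a b c d : ℕ} (ha : a ∈ E) (hb : b ∈ E) (hc : c ∈ E) (hd : d ∈ E)
    {u w : α} (huw : u ≠ w) (hau : H a u) (hcu : H c u) (hbw : H b w) (hdw : H d w)
    (hab : a ≠ b) (had : a ≠ d) (hcb : c ≠ b) (hcd : c ≠ d) :
    (a < b ∧ b < c ∨ c < b ∧ b < a) ↔ (a < d ∧ d < c ∨ c < d ∧ d < a) := by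
  have h1 : ¬ (a < b ∧ b < c ∧ c < d) := fun ⟨x, y, z⟩ =>
    huw (h a ha b hb c hc d hd x y z u w hau hcu hbw hdw)
  have h2 : ¬ (a < d ∧ d < c ∧ c < b) := fun ⟨x, y, z⟩ =>
    huw (h a ha d hd c hc b hb x y z u w hau hcu hdw hbw)
  have h3 : ¬ (c < b ∧ b < a ∧ a < d) := fun ⟨x, y, z⟩ =>
    huw (h c hc b hb a ha d hd x y z u w hcu hau hbw hdw)
  have h4 : ¬ (c < d ∧ d < a ∧ a < b) := fun ⟨x, y, z⟩ =>
    huw (h c hc d hd a ha b hb x y z u w hcu hau hdw hbw)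
  have h5 : ¬ (b < a ∧ a < d ∧ d < c) := fun ⟨x, y, z⟩ =>
    huw (h b hb a ha d hd c hc x y z w u hbw hdw hau hcu).symm
  have h6 : ¬ (b < c ∧ c < d ∧ d < a) := fun ⟨x, y, z⟩ =>
    huw (h b hb c hc d hd a ha x y z w u hbw hdw hcu hau).symm
  have h7 : ¬ (d < a ∧ a < b ∧ b < c) := fun ⟨x, y, z⟩ =>
    huw (h d hd a ha b hb c hc x y z w u hdw hbw hau hcu).symm
  have h8 : ¬ (d < c ∧ c < b ∧ b < a) := fun ⟨x, y, z⟩ =>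
    huw (h d hd c hc b hb a ha x y z w u hdw hbw hcu hau).symm
  omega

/-- Three colours at one point cannot all be joined pairwise at three further points. -/
lemma NonCrossing.false_of_triple {α : Type*} {E : Finset ℕ} {H : ℕ → α → Prop}
    (h : NonCrossing E H) {p a b c : ℕ} (hp : p ∈ E) (ha : a ∈ E) (hb : b ∈ E) (hc : c ∈ E)
    {u v w : α} (huv : u ≠ v) (huw : u ≠ w) (hpu : H p u) (hpv : H p v)
    (hau : H a u) (hav : H a v) (hbv : H b v) (hbw : H b w) (hcu : H c u)
    (hcw : H c w) (hpa : p ≠ a) (hpb : p ≠ b) (hpc : p ≠ c) (hab : a ≠ b) (hac : a ≠ c)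
    (hbc : b ≠ c) : False := by
  have h1 := h.between_iff ha hp hc hb huv hau hcu hpv hbv hpa.symm hab hpc.symm hbc.symm
  have h2 := h.between_iff hp hb ha hc huw hpu hau hbw hcw hpb hpc hab hac
  have h3 := h.between_iff hp ha hc hb huv hpu hcu hav hbv hpa hpb hac.symm hbc.symm
  clear * - h1 h2 h3 hpa hpb hpc hab hac hbc
  grind

/-- Two triangles of colours cannot share an edge. -/
lemma NonCrossing.false_of_diamond {α : Type*} {E : Finset ℕ} {H : ℕ → α → Prop}
    (h : NonCrossing E H) {p q r a c : ℕ} (hp : p ∈ E) (hq : q ∈ E) (hr : r ∈ E) (ha : a ∈ E)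
    (hc : c ∈ E) {i x z w : α} (hix : i ≠ x) (hiz : i ≠ z) (hiw : i ≠ w) (hxz : x ≠ z)
    (hxw : x ≠ w) (hzw : z ≠ w) (hpi : H p i) (hpx : H p x) (hqi : H q i) (hqz : H q z)
    (hrx : H r x) (hrz : H r z) (hai : H a i) (haw : H a w) (hcx : H c x) (hcw : H c w)
    (hpq : p ≠ q) (hpr : p ≠ r) (hpa : p ≠ a) (hpc : p ≠ c) (hqr : q ≠ r) (hqa : q ≠ a)
    (hqc : q ≠ c) (hra : r ≠ a) (hrc : r ≠ c) (hac : a ≠ c) : False := by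
  have h1 := h.between_iff hp hr hq hc hix hpi hqi hrx hcx hpr hpc hqr hqc
  have h2 := h.between_iff hp hr ha hc hix hpi hai hrx hcx hpr hpc hra.symm hac
  have h3 := h.between_iff hq hp ha hr hix hqi hai hpx hrx hpq.symm hqr hpa.symm hra.symm
  have h4 := h.between_iff hq hp ha hc hix hqi hai hpx hcx hpq.symm hqc hpa.symm hac
  have h5 := h.between_iff hq hr ha hc hix hqi hai hrx hcx hqr hqc hra.symm hac
  have h6 := h.between_iff hq ha hr hc hzw hqz hrz haw hcw hqa hqc hra hrc
  have h7 := h.between_iff hq hp hr hc hxz.symm hqz hrz hpx hcx hpq.symm hqc hpr.symm hrc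
  have h8 := h.between_iff ha hp hc hq hiw.symm haw hcw hpi hqi hpa.symm hqa.symm hpc.symm hqc.symm
  have h9 := h.between_iff hq hp hr ha hiz.symm hqz hrz hpi hai hpq.symm hqa hpr.symm hra
  have h10 := h.between_iff ha hp hc hr hxw.symm haw hcw hpx hrx hpa.symm hra.symm hpc.symm hrc.symm
  clear * - h1 h2 h3 h4 h5 h6 h7 h8 h9 h10 hpq hpr hpa hpc hqr hqa hqc hra hrc hac
  rcases hpq.lt_or_gt with e1 | e1 <;> rcases hpr.lt_or_gt with e2 | e2 <;>
    rcases hqr.lt_or_gt with e3 | e3 <;> rcases hpa.lt_or_gt with e4 | e4 <;> grind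

/-- Merging two colours that meet at a point creates no crossing among the other points. -/
lemma NonCrossing.merge {α : Type*} [DecidableEq α] {E : Finset ℕ} {H : ℕ → α → Prop}
    (h : NonCrossing E H) {p : ℕ} (hp : p ∈ E) {i x : α} (hpi : H p i) (hpx : H p x) :
    NonCrossing (E.erase p) (fun a u => ∃ v, H a v ∧ (if v = x then i else v) = u) := by
  rintro a ha b hb c hc d hd hab hbc hcd u w ⟨u₁, hau, rfl⟩ ⟨u₂, hcu, hu⟩ ⟨w₁, hbw, rfl⟩
    ⟨w₂, hdw, hw⟩
  obtain ⟨hap, ha⟩ := Finset.mem_erase.1 ha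
  obtain ⟨hbp, hb⟩ := Finset.mem_erase.1 hb
  obtain ⟨hcp, hc⟩ := Finset.mem_erase.1 hc
  obtain ⟨hdp, hd⟩ := Finset.mem_erase.1 hd
  -- If a merged class uses two colours, they are `i` and `x`, and `p` has both. Then `p` is on the
  -- same side of the other class's chord as each end of this one, yet the chord separates those
  -- ends.
  by_contra hne
  by_cases hu' : u₂ = u₁
  · subst hu'
    by_cases hw' : w₂ = w₁
    · subst hw'
      exact hne (by rw [h a ha b hb c hc d hd hab hbc hcd _ _ hau hcu hbw hdw])
    · have hpw₁ : H p w₁ := by grind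
      have hpw₂ : H p w₂ := by grind
      have n₁ : u₂ ≠ w₁ := by grind
      have n₂ : u₂ ≠ w₂ := by grind
      have h1 := h.between_iff ha hb hc hp n₁ hau hcu hbw hpw₁ hab.ne hap hbc.ne' hcp
      have h2 := h.between_iff ha hd hc hp n₂ hau hcu hdw hpw₂ (by omega) hap (by omega) hcp
      omega
  · have hpu₁ : H p u₁ := by grind
    have hpu₂ : H p u₂ := by grind
    have n₁ : w₁ ≠ u₁ := by grind
    have n₂ : w₁ ≠ u₂ := by grind
    have hw' : w₂ = w₁ := by grind
    subst hw'
    have h1 := h.between_iff hb ha hd hp n₁ hbw hdw hau hpu₁ (by omega) hbp (by omega) hdp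
    have h2 := h.between_iff hb hc hd hp n₂ hbw hdw hcu hpu₂ (by omega) hbp (by omega) hdp
    omega

/-- The points of `E` carry pairwise different pairs of colours `l p ≠ r p`. -/
def DistinctPairs {α : Type*} (E : Finset ℕ) (l r : ℕ → α) : Prop :=
  (∀ p ∈ E, l p ≠ r p) ∧ ∀ p ∈ E, ∀ q ∈ E, p ≠ q →
    ¬ (l p = l q ∧ r p = r q) ∧ ¬ (l p = r q ∧ r p = l q)

/-- A noncrossing system of distinct pairs of colours is a cactus: `2 n + 3 ≤ 3 k`. -/
lemma card_le_of_nonCrossing {α : Type*} [DecidableEq α] (n : ℕ) (E : Finset ℕ)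
    (hn : E.card = n) (C : Finset α) (l r : ℕ → α) (hC : C.Nonempty)
    (hlr : ∀ p ∈ E, l p ∈ C ∧ r p ∈ C) (hd : DistinctPairs E l r)
    (hnc : NonCrossing E (fun p u => l p = u ∨ r p = u)) : 2 * E.card + 3 ≤ 3 * C.card := by
  induction n using Nat.strong_induction_on generalizing E C l r with
  | _ n ih =>
  subst hn
  rcases E.eq_empty_or_nonempty with rfl | ⟨p, hp⟩
  · have := hC.card_pos
    simp; omega
  obtain ⟨hne, hdist⟩ := hd
  set i := l p with hi
  set x := r p with hx
  have hix : i ≠ x := hne p hp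
  obtain ⟨hiC, hxC⟩ : i ∈ C ∧ x ∈ C := hlr p hp
  let f : α → α := fun v => if v = x then i else v
  have hEp := Finset.card_erase_add_one hp
  have hCx := Finset.card_erase_add_one hxC
  have hne' : ∀ q ∈ E.erase p, f (l q) ≠ f (r q) := by
    intro q hq
    obtain ⟨hqp, hq⟩ := Finset.mem_erase.1 hq
    have h1 := hne q hq
    have h2 := hdist p hp q hq (Ne.symm hqp)
    simp only [f]
    grind
  have hfC : ∀ q ∈ E.erase p, f (l q) ∈ C.erase x ∧ f (r q) ∈ C.erase x := by
    intro q hq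
    have h1 := hlr q (Finset.mem_of_mem_erase hq)
    simp only [f, Finset.mem_erase]
    grind
  have hnc' : NonCrossing (E.erase p) (fun a u => f (l a) = u ∨ f (r a) = u) := by
    have := hnc.merge hp (i := i) (x := x) (Or.inl rfl) (Or.inr rfl)
    convert this using 3 with a u
    simp only [f]
    grind
  -- The edge `p` of the graph on the colours is contracted. Without parallel edges afterwards, one
  -- edge and one vertex are lost, which is more than enough.
  by_cases hinj : DistinctPairs (E.erase p) (fun q => f (l q)) (fun q => f (r q))
  · have := ih (E.erase p).card (by omega) (E.erase p) rfl (C.erase x) (fun q => f (l q))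
      (fun q => f (r q)) ⟨i, Finset.mem_erase.2 ⟨hix, hiC⟩⟩ hfC hinj hnc'
    omega
  · obtain ⟨q, hq, s, hs, hqs, hiq, hxs, z, hzi, hzx, hqz, hsz⟩ : ∃ q ∈ E.erase p,
        ∃ s ∈ E.erase p, q ≠ s ∧ (l q = i ∨ r q = i) ∧ (l s = x ∨ r s = x) ∧
        ∃ z, z ≠ i ∧ z ≠ x ∧ (l q = z ∨ r q = z) ∧ (l s = z ∨ r s = z) := by
      by_contra hcon
      refine hinj ⟨hne', fun q hq s hs hqs => ?_⟩
      have h1 := hdist q (Finset.mem_of_mem_erase hq) s (Finset.mem_of_mem_erase hs) hqs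
      have h2 := hne' q hq
      have h3 := hne' s hs
      have h4 : ∀ z, ¬ (z ≠ i ∧ z ≠ x ∧ (l q = i ∨ r q = i) ∧ (l s = x ∨ r s = x) ∧
          (l q = z ∨ r q = z) ∧ (l s = z ∨ r s = z)) := fun z h =>
        hcon ⟨q, hq, s, hs, hqs, h.2.2.1, h.2.2.2.1, z, h.1, h.2.1, h.2.2.2.2⟩
      have h5 : ∀ z, ¬ (z ≠ i ∧ z ≠ x ∧ (l s = i ∨ r s = i) ∧ (l q = x ∨ r q = x) ∧
          (l s = z ∨ r s = z) ∧ (l q = z ∨ r q = z)) := fun z h =>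
        hcon ⟨s, hs, q, hq, hqs.symm, h.2.2.1, h.2.2.2.1, z, h.1, h.2.1, h.2.2.2.2⟩
      have a1 := h4 (l q)
      have a2 := h4 (r q)
      have a3 := h5 (l q)
      have a4 := h5 (r q)
      simp only [f] at h2 h3 ⊢
      grind
    obtain ⟨hqp, hqE⟩ := Finset.mem_erase.1 hq
    obtain ⟨hsp, hsE⟩ := Finset.mem_erase.1 hs
    have hzC : z ∈ C := by have := hlr q hqE; grind
    let g : α → α := fun v => if v = z then i else v
    set F := ((E.erase p).erase q).erase s with hF
    have hFcard : F.card + 3 = E.card := by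
      have h1 := Finset.card_erase_add_one hq
      have h2 := Finset.card_erase_add_one (Finset.mem_erase.2 ⟨hqs.symm, hs⟩)
      rw [hF]
      omega
    have hzCx : z ∈ C.erase x := Finset.mem_erase.2 ⟨hzx, hzC⟩
    have hCz := Finset.card_erase_add_one hzCx
    have hmemF : ∀ t ∈ F, t ∈ E ∧ t ≠ p ∧ t ≠ q ∧ t ≠ s := by
      intro t ht
      simp only [hF, Finset.mem_erase] at ht
      tauto
    have hnc'' : NonCrossing F (fun a u => g (f (l a)) = u ∨ g (f (r a)) = u) := by
      have := hnc'.merge hq (i := i) (x := z) (by simp only [f]; grind) (by simp only [f]; grind)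
      have := this.mono (Finset.erase_subset s _)
      convert this using 3 with a u
      simp only [g, f]
      grind
    have hpE := hp
    have hqcol : ∀ v, (l q = v ∨ r q = v) ↔ (v = i ∨ v = z) := by
      intro v; have := hne q hqE; grind
    have hscol : ∀ v, (l s = v ∨ r s = v) ↔ (v = x ∨ v = z) := by
      intro v; have := hne s hsE; grind
    have hpcol : ∀ v, (l p = v ∨ r p = v) ↔ (v = i ∨ v = x) := by
      intro v; grind
    have hne'' : ∀ t ∈ F, g (f (l t)) ≠ g (f (r t)) := by
      intro t ht
      obtain ⟨htE, htp, htq, hts⟩ := hmemF t ht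
      have h1 := hdist p hpE t htE (Ne.symm htp)
      have h2 := hdist q hqE t htE (Ne.symm htq)
      have h3 := hdist s hsE t htE (Ne.symm hts)
      have h4 := hne t htE
      have h5 := hne q hqE
      have h6 := hne s hsE
      simp only [f, g]
      grind
    -- Parallel edges after this second contraction would come from another triangle that shares an
    -- edge with the first.
    have hdia : ∀ t ∈ F, ∀ t' ∈ F, t ≠ t' → ∀ w, w ≠ i → w ≠ x → w ≠ z →
        (l t = w ∨ r t = w) → (l t' = w ∨ r t' = w) →
        ¬ ((l t = i ∨ r t = i) ∧ (l t' = x ∨ r t' = x)) ∧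
        ¬ ((l t = i ∨ r t = i) ∧ (l t' = z ∨ r t' = z)) ∧
        ¬ ((l t = x ∨ r t = x) ∧ (l t' = z ∨ r t' = z)) := by
      intro t ht t' ht' htt w hwi hwx hwz htw htw'
      obtain ⟨htE, htp, htq, hts⟩ := hmemF t ht
      obtain ⟨htE', htp', htq', hts'⟩ := hmemF t' ht'
      refine ⟨fun h => ?_, fun h => ?_, fun h => ?_⟩
      · exact hnc.false_of_diamond hpE hqE hsE htE htE' hix hzi.symm hwi.symm hzx.symm hwx.symm
          hwz.symm (Or.inl rfl) (Or.inr rfl) hiq hqz hxs hsz h.1 htw h.2 htw'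
          hqp.symm hsp.symm htp.symm htp'.symm hqs htq.symm htq'.symm hts.symm hts'.symm htt
      · exact hnc.false_of_diamond hqE hpE hsE htE htE' hzi.symm hix hwi.symm hzx hwz.symm
          hwx.symm hiq hqz (Or.inl rfl) (Or.inr rfl) hsz hxs h.1 htw h.2 htw'
          hqp hqs htq.symm htq'.symm hsp.symm htp.symm htp'.symm hts.symm hts'.symm htt
      · exact hnc.false_of_diamond hsE hpE hqE htE htE' hzx.symm hix.symm hwx.symm hzi hwz.symm
          hwi.symm hxs hsz (Or.inr rfl) (Or.inl rfl) hqz hiq h.1 htw h.2 htw'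
          hsp hqs.symm hts.symm hts'.symm hqp.symm htp.symm htp'.symm htq.symm htq'.symm htt
    have hinj' : DistinctPairs F (fun t => g (f (l t))) (fun t => g (f (r t))) := by
      refine ⟨hne'', fun t ht t' ht' htt => ?_⟩
      have h1 := hdist t (hmemF t ht).1 t' (hmemF t' ht').1 htt
      have h2 := hne'' t ht
      have h3 := hne'' t' ht'
      have a1 := hdia t ht t' ht' htt (l t)
      have a2 := hdia t ht t' ht' htt (r t)
      have a3 := hdia t' ht' t ht htt.symm (l t)
      have a4 := hdia t' ht' t ht htt.symm (r t)
      clear hdia hnc hnc' hnc'' hlr hdist hmemF ih hinj hqcol hscol hpcol hne' hfC hne''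
      simp only [f, g] at h2 h3 ⊢
      grind
    have := ih F.card (by omega) F rfl ((C.erase x).erase z) (fun t => g (f (l t)))
      (fun t => g (f (r t)))
      ⟨i, Finset.mem_erase.2 ⟨hzi.symm, Finset.mem_erase.2 ⟨hix, hiC⟩⟩⟩ (by
        intro t ht
        obtain ⟨htE, htp, htq, hts⟩ := hmemF t ht
        have h1 := hlr t htE
        simp only [f, g, Finset.mem_erase]
        grind) hinj' hnc''
    omega

/-- If every point has at least two colours, and two points never have the same two colours and
no others, then distinct pairs of colours can be chosen. -/
lemma NonCrossing.exists_distinctPairs {α : Type*} [Nonempty α] {E : Finset ℕ}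
    {H : ℕ → α → Prop} (hnc : NonCrossing E H)
    (htwo : ∀ p ∈ E, ∃ u w, u ≠ w ∧ H p u ∧ H p w)
    (hsame : ∀ p ∈ E, ∀ q ∈ E, p ≠ q → ∀ u w, u ≠ w → H p u → H p w → H q u → H q w →
      ∃ v, v ≠ u ∧ v ≠ w ∧ (H p v ∨ H q v)) :
    ∃ l r : ℕ → α, DistinctPairs E l r ∧ ∀ p ∈ E, H p (l p) ∧ H p (r p) := by
  classical
  -- Points with only two colours have no choice, and `hsame` keeps their pairs distinct. The points
  -- with three or more colours are then added one at a time.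
  set T : ℕ → Prop := fun p => ∃ u v w, u ≠ v ∧ u ≠ w ∧ v ≠ w ∧ H p u ∧ H p v ∧ H p w with hT
  suffices hG : ∀ G : Finset ℕ, G ⊆ E.filter T → ∃ l r : ℕ → α,
      DistinctPairs (E.filter (fun p => ¬ T p) ∪ G) l r ∧
      ∀ p ∈ E.filter (fun p => ¬ T p) ∪ G, H p (l p) ∧ H p (r p) by
    have := hG (E.filter T) subset_rfl
    rwa [Finset.union_comm, Finset.filter_union_filter_not_eq] at this
  intro G
  induction G using Finset.induction_on with
  | empty =>
    intro _
    rw [Finset.union_empty]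
    choose! l r hlr using htwo
    refine ⟨l, r, ⟨fun p hp => (hlr p (Finset.mem_filter.1 hp).1).1, ?_⟩,
      fun p hp => (hlr p (Finset.mem_filter.1 hp).1).2⟩
    intro p hp q hq hpq
    obtain ⟨hp, hTp⟩ := Finset.mem_filter.1 hp
    obtain ⟨hq, hTq⟩ := Finset.mem_filter.1 hq
    have key : ¬ (H q (l p) ∧ H q (r p)) := by
      rintro ⟨h1, h2⟩
      obtain ⟨v, hv1, hv2, hv⟩ := hsame p hp q hq hpq _ _ (hlr p hp).1 (hlr p hp).2.1
        (hlr p hp).2.2 h1 h2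
      rcases hv with hv | hv
      · exact hTp ⟨l p, r p, v, (hlr p hp).1, hv1.symm, hv2.symm, (hlr p hp).2.1,
          (hlr p hp).2.2, hv⟩
      · exact hTq ⟨l p, r p, v, (hlr p hp).1, hv1.symm, hv2.symm, h1, h2, hv⟩
    constructor
    · rintro ⟨h1, h2⟩
      exact key ⟨h1 ▸ (hlr q hq).2.1, h2 ▸ (hlr q hq).2.2⟩
    · rintro ⟨h1, h2⟩
      exact key ⟨h1 ▸ (hlr q hq).2.2, h2 ▸ (hlr q hq).2.1⟩
  | insert p G hpG ih =>
    intro hsub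
    obtain ⟨l, r, ⟨hne, hdist⟩, hlr⟩ := ih ((Finset.subset_insert p G).trans hsub)
    obtain ⟨hpE, u, v, w, huv, huw, hvw, hu, hv, hw⟩ :=
      Finset.mem_filter.1 (hsub (Finset.mem_insert_self p G))
    set F := E.filter (fun p => ¬ T p) ∪ G with hF
    have hFE : F ⊆ E := Finset.union_subset (Finset.filter_subset _ _)
      (((Finset.subset_insert p G).trans hsub).trans (Finset.filter_subset _ _))
    have hpF : p ∉ F := by
      rw [hF, Finset.mem_union, Finset.mem_filter]
      rintro (h | h)
      · exact h.2 (Finset.mem_filter.1 (hsub (Finset.mem_insert_self p G))).2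
      · exact hpG h
    have hpne : ∀ q ∈ F, p ≠ q := fun q hq h => hpF (h ▸ hq)
    -- Three colours at `p` offer three pairs. If all were taken, the three points that hold them
    -- would contradict `NonCrossing.false_of_triple`.
    have hfree : ∃ s t, s ≠ t ∧ H p s ∧ H p t ∧ ∀ q ∈ F,
        ¬ (s = l q ∧ t = r q) ∧ ¬ (s = r q ∧ t = l q) := by
      by_contra! hcon
      have used : ∀ s t, s ≠ t → H p s → H p t →
          ∃ q ∈ F, (l q = s ∧ r q = t) ∨ (l q = t ∧ r q = s) := by
        intro s t hst hs ht
        obtain ⟨q, hq, h⟩ := hcon s t hst hs ht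
        refine ⟨q, hq, ?_⟩
        by_cases h' : s = l q ∧ t = r q
        · exact Or.inl ⟨h'.1.symm, h'.2.symm⟩
        · have := h (by tauto)
          exact Or.inr ⟨this.2.symm, this.1.symm⟩
      obtain ⟨a, ha, ha'⟩ := used u v huv hu hv
      obtain ⟨b, hb, hb'⟩ := used v w hvw hv hw
      obtain ⟨c, hc, hc'⟩ := used u w huw hu hw
      have hA := hlr a ha
      have hB := hlr b hb
      have hC := hlr c hc
      refine hnc.false_of_triple hpE (hFE ha) (hFE hb) (hFE hc) huv huw hu hv
        (a := a) (b := b) (c := c) ?_ ?_ ?_ ?_ ?_ ?_ (hpne a ha) (hpne b hb) (hpne c hc) ?_ ?_ ?_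
      all_goals
        clear hcon used hsame htwo ih hsub hdist hlr hne hF hFE hpne hpF hnc
        grind
    obtain ⟨s, t, hst, hs, ht, hfree⟩ := hfree
    rw [Finset.union_insert]
    have hl : ∀ q ∈ F, Function.update l p s q = l q := fun q hq =>
      Function.update_of_ne (hpne q hq).symm _ _
    have hr : ∀ q ∈ F, Function.update r p t q = r q := fun q hq =>
      Function.update_of_ne (hpne q hq).symm _ _
    refine ⟨Function.update l p s, Function.update r p t, ⟨?_, ?_⟩, ?_⟩
    · intro q hq
      rcases Finset.mem_insert.1 hq with rfl | hq
      · simpa using hst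
      · rw [hl q hq, hr q hq]; exact hne q hq
    · intro q hq q' hq' hqq
      rcases Finset.mem_insert.1 hq with rfl | hqF
      · rcases Finset.mem_insert.1 hq' with rfl | hq'
        · exact absurd rfl hqq
        · rw [hl q' hq', hr q' hq', Function.update_self, Function.update_self]
          exact hfree q' hq'
      · rcases Finset.mem_insert.1 hq' with rfl | hq'
        · rw [hl q hqF, hr q hqF, Function.update_self, Function.update_self]
          have := hfree q hqF
          clear * - this
          grind
        · rw [hl q hqF, hr q hqF, hl q' hq', hr q' hq']
          exact hdist q hqF q' hq' hqq
    · intro q hq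
      rcases Finset.mem_insert.1 hq with rfl | hq
      · simpa using ⟨hs, ht⟩
      · rw [hl q hq, hr q hq]; exact hlr q hq


/-! ### Germs of convex sets at the points of `P` -/

/-- The set `K` contains an initial open segment of the ray from `p` in direction `u`. -/
def Germ (K : Set Plane) (p u : Plane) : Prop := ∀ᶠ ε : ℝ in 𝓝[>] 0, p + ε • u ∈ K

lemma EncapsulatesPoint.notMem {k : ℕ} {K : Fin k → Set Plane} {p : Plane}
    (h : EncapsulatesPoint K p) (i : Fin k) : p ∉ K i := by
  obtain ⟨N, hN, h⟩ := h
  intro hp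
  have : p ∈ N \ {p} := h ▸ ⟨Set.mem_iUnion.2 ⟨i, hp⟩, mem_of_mem_nhds hN⟩
  exact this.2 rfl

/-- The admissible `ε` form an interval, so as soon as they accumulate at `0` from the right they
fill some `(0, ε₀)`. -/
lemma germ_of_frequently {K : Set Plane} (hK : Convex ℝ K) {p u : Plane}
    (h : ∃ᶠ ε : ℝ in 𝓝[>] 0, p + ε • u ∈ K) : Germ K p u := by
  obtain ⟨ε₀, h₀, hε₀⟩ := (h.and_eventually self_mem_nhdsWithin).exists
  filter_upwards [Ioo_mem_nhdsGT hε₀] with ε hε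
  obtain ⟨ε₁, h₁, hε₁⟩ := (h.and_eventually (Ioo_mem_nhdsGT hε.1)).exists
  have hd : 0 < ε₀ - ε₁ := by linarith [hε₁.2, hε.2]
  have := hK h₁ h₀ (a := (ε₀ - ε) / (ε₀ - ε₁)) (b := (ε - ε₁) / (ε₀ - ε₁))
    (div_nonneg (by linarith [hε.2]) hd.le) (div_nonneg (by linarith [hε₁.2]) hd.le)
    (by field_simp; ring)
  convert this using 1
  apply plane_ext <;> simp <;> field_simp <;> ring

/-- With finitely many sets and no germ, a whole initial segment of the ray would miss all of them,
although it lies in the punctured neighbourhood. -/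
lemma EncapsulatesPoint.exists_germ {k : ℕ} {K : Fin k → Set Plane} {p u : Plane}
    (h : EncapsulatesPoint K p) (hK : ∀ i, Convex ℝ (K i)) (hu : u ≠ 0) :
    ∃ i, Germ (K i) p u := by
  by_contra! hcon
  have hnot : ∀ᶠ ε : ℝ in 𝓝[>] 0, ∀ i, p + ε • u ∉ K i :=
    Filter.eventually_all.2 fun i =>
      Filter.not_frequently.1 fun hf => hcon i (germ_of_frequently (hK i) hf)
  obtain ⟨N, hN, h⟩ := h
  have hcont : Continuous fun ε : ℝ => p + ε • u := by fun_prop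
  have hNε : ∀ᶠ ε : ℝ in 𝓝[>] 0, p + ε • u ∈ N := by
    refine ((hcont.tendsto 0).eventually ?_).filter_mono nhdsWithin_le_nhds
    simpa using hN
  obtain ⟨ε, ⟨h1, h2⟩, h3⟩ := ((hnot.and hNε).and self_mem_nhdsWithin).exists
  have : p + ε • u ∈ (⋃ i, K i) ∩ N := by
    rw [h]
    refine ⟨h2, ?_⟩
    have : ε ≠ 0 := ne_of_gt h3
    simp [this, hu]
  obtain ⟨i, hi⟩ := Set.mem_iUnion.1 this.1
  exact h1 i hi

/-- As no set contains `p`, opposite directions at `p` belong to different sets; hence every point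
has two colours. -/
lemma Germ.mem_of_neg {K : Set Plane} (hK : Convex ℝ K) {p u : Plane} (h : Germ K p u)
    (h' : Germ K p (-u)) : p ∈ K := by
  obtain ⟨ε, h1, h2⟩ := (h.and h').exists
  convert hK h1 h2 (a := 1 / 2) (b := 1 / 2) (by norm_num) (by norm_num) (by norm_num) using 1
  apply plane_ext <;> simp <;> ring

/-- A convex set that continues the segment from `p` to `q` beyond both ends contains `p`. -/
lemma Germ.mem_of_outward {K : Set Plane} (hK : Convex ℝ K) {p q : Plane}
    (h : Germ K p (p - q)) (h' : Germ K q (q - p)) : p ∈ K := by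
  obtain ⟨ε, ⟨h1, h2⟩, h3⟩ := ((h.and h').and self_mem_nhdsWithin).exists
  have hε : (0 : ℝ) < ε := h3
  convert hK h1 h2 (a := (1 + ε) / (1 + 2 * ε)) (b := ε / (1 + 2 * ε)) (by positivity)
    (by positivity) (by field_simp; ring) using 1
  apply plane_ext <;> simp <;> field_simp <;> ring

/-- A convex set that contains a point and continues the ray from it beyond `q` contains `q`. -/
lemma Germ.mem_of_mem {K : Set Plane} (hK : Convex ℝ K) {O q : Plane} (hO : O ∈ K)
    (h : Germ K q (q - O)) : q ∈ K := by
  obtain ⟨ε, h1, h3⟩ := (h.and self_mem_nhdsWithin).exists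
  have hε : (0 : ℝ) < ε := h3
  convert hK hO h1 (a := ε / (1 + ε)) (b := 1 / (1 + ε)) (by positivity)
    (by positivity) (by field_simp; ring) using 1
  apply plane_ext <;> simp <;> field_simp <;> ring

lemma Germ.mem_of_parallel {K : Set Plane} (hK : Convex ℝ K) {p q : Plane}
    (h : Germ K p (q - p)) (h' : Germ K q (q - p)) : q ∈ K := by
  obtain ⟨ε, ⟨h1, h2⟩, h3⟩ := ((h.and h').and (Ioo_mem_nhdsGT one_pos)).exists
  convert hK h1 h2 (a := ε) (b := 1 - ε) h3.1.le (by linarith [h3.2]) (by ring) using 1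
  apply plane_ext <;> simp <;> ring

/-- If at most the coordinate of `q` is negative in the barycentric coordinates of `O`, a convex
set that continues the rays from `O` beyond `p`, `q` and `r` contains `q`. -/
lemma Germ.mem_of_barycentric {K : Set Plane} (hK : Convex ℝ K) {O p q r : Plane}
    {α β γ : ℝ} (hsum : α + β + γ = 1) (hO : O = α • p + β • q + γ • r) (hα : 0 ≤ α)
    (hγ : 0 ≤ γ) (hp : Germ K p (p - O)) (hq : Germ K q (q - O)) (hr : Germ K r (r - O)) :
    q ∈ K := by
  -- The weight of `q` is positive for small `ε` even when `β < 0`. The germ points are `(1 + ε) z -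
  -- ε O`, and in the weighted sum the multiples of `O` cancel.
  have hsmall : ∀ᶠ ε : ℝ in 𝓝[>] 0, 0 < 1 + ε * β := by
    have hcont : Continuous fun ε : ℝ => 1 + ε * β := by fun_prop
    exact ((hcont.tendsto 0).eventually (lt_mem_nhds (by simp))).filter_mono nhdsWithin_le_nhds
  obtain ⟨ε, ⟨⟨⟨h1, h2⟩, h3⟩, h4⟩, h5⟩ :=
    ((((hp.and hq).and hr).and hsmall).and self_mem_nhdsWithin).exists
  have hε : (0 : ℝ) < ε := h5
  have := hK.sum_mem (t := Finset.univ)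
    (w := ![ε * α / (1 + ε), (1 + ε * β) / (1 + ε), ε * γ / (1 + ε)])
    (z := ![p + ε • (p - O), q + ε • (q - O), r + ε • (r - O)]) (by
      intro i _
      fin_cases i <;> simp <;> positivity) (by
      simp [Fin.sum_univ_three]
      field_simp
      linear_combination ε * hsum) (by
      intro i _
      fin_cases i <;> simpa)
  convert this using 1
  obtain rfl : β = 1 - α - γ := by linarith
  subst hO
  simp only [Fin.sum_univ_three]
  apply plane_ext <;> simp <;> field_simp <;> ring

lemma exists_barycentric {p q r : Plane} (h : orient p q r ≠ 0) (O : Plane) :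
    ∃ α β γ : ℝ, α + β + γ = 1 ∧ O = α • p + β • q + γ • r := by
  refine ⟨orient q r O / orient p q r, orient r p O / orient p q r, orient p q O / orient p q r,
    ?_, ?_⟩
  · field_simp
    simp only [orient]; ring
  · apply plane_ext
    · simp only [PiLp.add_apply, PiLp.smul_apply, smul_eq_mul]
      field_simp
      simp only [orient]; ring
    · simp only [PiLp.add_apply, PiLp.smul_apply, smul_eq_mul]
      field_simp
      simp only [orient]; ring

/-- A linear functional that separates `q` from the other points attains its maximum over the hull
at `q` alone, so deleting `q` amounts to intersecting with an open half-plane. -/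
lemma ConvexPosition.convex_diff {P : Finset Plane} (hP : ConvexPosition P) {q : Plane}
    (hq : q ∈ P) : Convex ℝ (convexHull ℝ (P : Set Plane) \ {q}) := by
  obtain ⟨f, c, hf, hc⟩ := geometric_hahn_banach_closed_point (convex_convexHull ℝ _)
    ((P.finite_toSet.subset Set.sdiff_subset).isClosed_convexHull ℝ) (hP.notMem hq)
  have hlt : ∀ z ∈ P, z ≠ q → f z < f q := fun z hz hzq =>
    (hf z (subset_convexHull ℝ _ ⟨hz, hzq⟩)).trans hc
  have hsub : convexHull ℝ (P : Set Plane) ⊆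
      {z | 0 < f q - f z ∨ f q - f z = 0 ∧ z ∈ ({q} : Set Plane)} := by
    refine convexHull_min (fun z hz => ?_) (convex_halfPlane_union ?_ (convex_singleton q))
    · by_cases hzq : z = q
      · exact Or.inr ⟨by simp [hzq], hzq⟩
      · exact Or.inl (sub_pos.2 (hlt z hz hzq))
    · intro x y s t hst
      simp only [map_add, map_smul, smul_eq_mul]
      linear_combination (-f q) * hst
  have : convexHull ℝ (P : Set Plane) \ {q} =
      convexHull ℝ (P : Set Plane) ∩ {z | f z < f q} := by
    ext z
    refine and_congr_right fun hz => ⟨fun h => ?_, fun h e => ?_⟩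
    · rcases hsub hz with h' | h'
      · exact sub_pos.1 h'
      · exact absurd h'.2 h
    · obtain rfl : z = q := e
      exact lt_irrefl (f z) h
  rw [this]
  exact (convex_convexHull ℝ _).inter (convex_halfSpace_lt f.toLinearMap.isLinear _)

/-- In the barycentric coordinates of a point of the hull with respect to three points in convex
position, no two coordinates are negative. -/
lemma ConvexPosition.not_two_neg {P : Finset Plane} (hP : ConvexPosition P) {O p q r : Plane}
    (hO : O ∈ convexHull ℝ (P : Set Plane)) (hp : p ∈ P) (hq : q ∈ P) (hr : r ∈ P) (hOq : O ≠ q)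
    (hpq : p ≠ q) (hqr : q ≠ r) {α β γ : ℝ} (hsum : α + β + γ = 1)
    (h : O = α • p + β • q + γ • r) (hα : α < 0) (hγ : γ < 0) : False := by
  have hβ : 0 < β := by linarith
  have hsub := subset_convexHull ℝ (P : Set Plane)
  -- Solved for `q`, the relation exhibits `q` as a convex combination of `O`, `p`, `r`, all in the
  -- hull and different from `q`.
  have := (hP.convex_diff hq).sum_mem (t := Finset.univ)
    (w := ![1 / β, -α / β, -γ / β]) (z := ![O, p, r]) (by
      intro i _
      fin_cases i
      · simp; positivity
      · exact div_nonneg (by linarith) hβ.le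
      · exact div_nonneg (by linarith) hβ.le) (by
      simp [Fin.sum_univ_three]
      field_simp
      linarith) (by
      intro i _
      fin_cases i
      · exact ⟨hO, hOq⟩
      · exact ⟨hsub hp, hpq⟩
      · exact ⟨hsub hr, hqr.symm⟩)
  refine this.2 ?_
  subst h
  simp only [Fin.sum_univ_three, Set.mem_singleton_iff]
  apply plane_ext <;> simp <;> field_simp <;> ring

/-- At most one barycentric coordinate of `O` is negative. The vertex it belongs to, or any vertex
if there is none, is forced into `K`. -/
lemma ConvexPosition.false_of_three_germs {P : Finset Plane} (hP : ConvexPosition P)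
    {K : Set Plane} (hK : Convex ℝ K) (hPK : ∀ p ∈ P, p ∉ K) {O p q r : Plane}
    (hO : O ∈ convexHull ℝ (P : Set Plane)) (hOP : O ∉ P) (hp : p ∈ P) (hq : q ∈ P) (hr : r ∈ P)
    (hpq : p ≠ q) (hpr : p ≠ r) (hqr : q ≠ r) (gp : Germ K p (p - O)) (gq : Germ K q (q - O))
    (gr : Germ K r (r - O)) : False := by
  obtain ⟨α, β, γ, hsum, h⟩ :=
    exists_barycentric (hP.generalPosition.orient_ne_zero hp hq hr hpq hpr hqr) O
  have hne : ∀ z ∈ P, O ≠ z := fun z hz e => hOP (e ▸ hz)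
  have h' : O = β • q + γ • r + α • p := by rw [h]; abel
  have h'' : O = γ • r + α • p + β • q := by rw [h]; abel
  have s' : β + γ + α = 1 := by linarith
  have s'' : γ + α + β = 1 := by linarith
  rcases lt_or_ge α 0 with hα | hα <;> rcases lt_or_ge β 0 with hβ | hβ <;>
    rcases lt_or_ge γ 0 with hγ | hγ
  · linarith
  · exact hP.not_two_neg hO hq hr hp (hne r hr) hqr hpr.symm s' h' hβ hα
  · exact hP.not_two_neg hO hp hq hr (hne q hq) hpq hqr hsum h hα hγ
  · exact hPK p hp (gr.mem_of_barycentric hK s'' h'' hγ hβ gp gq)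
  · exact hP.not_two_neg hO hr hp hq (hne p hp) hpr.symm hpq s'' h'' hγ hβ
  · exact hPK q hq (gp.mem_of_barycentric hK hsum h hα hγ gq gr)
  · exact hPK r hr (gq.mem_of_barycentric hK s' h' hβ hα gr gp)
  · exact hPK q hq (gp.mem_of_barycentric hK hsum h hα hγ gq gr)

/-- If two of the sets meet in the hull of `P`, then `n + 4 ≤ 2 k`. -/
lemma ConvexPosition.card_add_four_le {P : Finset Plane} (hP : ConvexPosition P) {k : ℕ}
    {K : Fin k → Set Plane} (hK : ∀ i, Convex ℝ (K i)) (hE : Encapsulates K P) {a b : Fin k}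
    (hab : a ≠ b) {O : Plane} (hOa : O ∈ K a) (hOb : O ∈ K b)
    (hO : O ∈ convexHull ℝ (P : Set Plane)) : P.card + 4 ≤ 2 * k := by
  classical
  have hPK : ∀ i, ∀ p ∈ P, p ∉ K i := fun i p hp => (hE p hp).notMem i
  have hOP : O ∉ P := fun h => hPK a O h hOa
  have hex : ∀ p ∈ P, ∃ i, Germ (K i) p (p - O) := fun p hp =>
    (hE p hp).exists_germ hK (sub_ne_zero.2 fun h => hOP (h ▸ hp))
  have : Nonempty (Fin k) := ⟨a⟩
  choose! i hi using hex
  -- The sets `K a` and `K b` contain `O`; continuing a ray from `O` beyond `p` would make them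
  -- contain `p`.
  have hcard := Finset.card_le_mul_card_image_of_maps_to (s := P) (f := i)
    (t := (Finset.univ.erase a).erase b) (by
      intro p hp
      refine Finset.mem_erase.2 ⟨?_, Finset.mem_erase.2 ⟨?_, Finset.mem_univ _⟩⟩
      · exact fun h => hPK b p hp (Germ.mem_of_mem (hK b) hOb (h ▸ hi p hp))
      · exact fun h => hPK a p hp (Germ.mem_of_mem (hK a) hOa (h ▸ hi p hp))) 2 (by
      intro c _
      by_contra! hlt
      obtain ⟨p, q, r, hp, hq, hr, hpq, hpr, hqr⟩ := Finset.two_lt_card_iff.1 hlt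
      obtain ⟨hpP, rfl⟩ := Finset.mem_filter.1 hp
      obtain ⟨hq, eq⟩ := Finset.mem_filter.1 hq
      obtain ⟨hr, er⟩ := Finset.mem_filter.1 hr
      exact hP.false_of_three_germs (hK (i p)) (hPK _) hO hOP hpP hq hr hpq hpr hqr (hi p hpP)
        (eq ▸ hi q hq) (er ▸ hi r hr))
  have h1 := Finset.card_erase_add_one (Finset.mem_univ a)
  have h2 := Finset.card_erase_add_one
    (Finset.mem_erase.2 ⟨hab.symm, Finset.mem_univ b⟩ : b ∈ Finset.univ.erase a)
  rw [Finset.card_univ, Fintype.card_fin] at h1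
  omega

/-! ### The lower bound for sets that are disjoint inside the hull -/

lemma Continuous.orient {A B C : ℝ → Plane} (hA : Continuous A) (hB : Continuous B)
    (hC : Continuous C) : Continuous fun ε => orient (A ε) (B ε) (C ε) := by
  unfold _root_.orient
  fun_prop

/-- The diagonals of a convex quadrilateral meet. -/
lemma exists_crossing {A B C D : Plane} (h1 : 0 < orient A B C) (h2 : 0 < orient B C D)
    (h3 : 0 < orient C D A) (h4 : 0 < orient D A B) :
    ∃ X ∈ segment ℝ A C, X ∈ segment ℝ B D ∧ ∀ a b,
      0 < orient B C D * orient a b A + orient D A B * orient a b C → 0 < orient a b X := by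
  have hS : orient B C D + orient D A B = orient A B C + orient C D A := by
    simp only [orient]; ring
  have hpos : 0 < orient B C D + orient D A B := by linarith
  have e1 : orient B C D / (orient B C D + orient D A B) +
    orient D A B / (orient B C D + orient D A B) = 1 := by field_simp
  -- The weights are proportional to the distances of `C` and `A` from the line `B D`.
  refine ⟨(orient B C D / (orient B C D + orient D A B)) • A +
    (orient D A B / (orient B C D + orient D A B)) • C, ?_, ?_, ?_⟩
  · exact ⟨_, _, by positivity, by positivity, e1, rfl⟩
  · refine ⟨orient C D A / (orient B C D + orient D A B),
      orient A B C / (orient B C D + orient D A B), by positivity, by positivity, ?_, ?_⟩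
    · rw [hS]; field_simp; ring
    · apply plane_ext
      · simp only [PiLp.add_apply, PiLp.smul_apply, smul_eq_mul]
        field_simp
        simp only [orient]; ring
      · simp only [PiLp.add_apply, PiLp.smul_apply, smul_eq_mul]
        field_simp
        simp only [orient]; ring
  · intro a b h
    rw [orient_comb _ _ _ _ e1]
    have := div_pos h hpos
    rwa [div_mul_eq_mul_div, div_mul_eq_mul_div, ← add_div]

/-- Two convex sets that reach alternate vertices of a convex quadrilateral meet inside it. -/
lemma exists_mem_convexHull_of_germs {S K L : Set Plane} (hK : Convex ℝ K) (hL : Convex ℝ L)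
    {p q r s u v w z : Plane} (hp : p ∈ S) (hq : q ∈ S) (hr : r ∈ S) (hs : s ∈ S)
    (h1 : 0 < orient p q r) (h2 : 0 < orient q r s) (h3 : 0 < orient r s p)
    (h4 : 0 < orient s p q) (gp : Germ K p u) (gr : Germ K r v) (gq : Germ L q w)
    (gs : Germ L s z) : ∃ X ∈ K, X ∈ L ∧ X ∈ convexHull ℝ S := by
  have cline : ∀ a b : Plane, Continuous fun ε : ℝ => a + ε • b := fun a b => by fun_prop
  have cconst : ∀ a : Plane, Continuous fun _ : ℝ => a := fun a => continuous_const
  have hev : ∀ g : ℝ → ℝ, Continuous g → 0 < g 0 → ∀ᶠ ε : ℝ in 𝓝[>] 0, 0 < g ε := fun g hg h =>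
    ((hg.tendsto 0).eventually (lt_mem_nhds h)).filter_mono nhdsWithin_le_nhds
  have cABC := (cline p u).orient (cline q w) (cline r v)
  have cBCD := (cline q w).orient (cline r v) (cline s z)
  have cCDA := (cline r v).orient (cline s z) (cline p u)
  have cDAB := (cline s z).orient (cline p u) (cline q w)
  have cside : ∀ a b, Continuous fun ε : ℝ =>
      orient (q + ε • w) (r + ε • v) (s + ε • z) * orient a b (p + ε • u) +
      orient (s + ε • z) (p + ε • u) (q + ε • w) * orient a b (r + ε • v) := fun a b =>
    (cBCD.mul ((cconst a).orient (cconst b) (cline p u))).add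
      (cDAB.mul ((cconst a).orient (cconst b) (cline r v)))
  have e1 := hev _ cABC (by simpa using h1)
  have e2 := hev _ cBCD (by simpa using h2)
  have e3 := hev _ cCDA (by simpa using h3)
  have e4 := hev _ cDAB (by simpa using h4)
  -- The crossing of the perturbed diagonals stays inside the four original sides: the expressions
  -- are positive at `ε = 0`, hence for small `ε`.
  have f1 := hev _ (cside p q) (by simpa using mul_pos h4 h1)
  have f2 := hev _ (cside q r) (by simpa [orient_rot] using mul_pos h2 h1)
  have f3 := hev _ (cside r s) (by simpa using mul_pos h2 h3)
  have f4 := hev _ (cside s p) (by simpa [orient_rot] using mul_pos h4 h3)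
  obtain ⟨ε, hε⟩ := (((((((((((e1.and e2).and e3).and e4).and f1).and f2).and f3).and f4).and
    gp).and gr).and gq).and gs).exists
  obtain ⟨⟨⟨⟨⟨⟨⟨⟨⟨⟨⟨e1, e2⟩, e3⟩, e4⟩, f1⟩, f2⟩, f3⟩, f4⟩, gp⟩, gr⟩, gq⟩, gs⟩ := hε
  obtain ⟨X, hX1, hX2, hX⟩ := exists_crossing e1 e2 e3 e4
  refine ⟨X, hK.segment_subset gp gr hX1, hL.segment_subset gq gs hX2, ?_⟩
  rcases le_total 0 (orient r p X) with h | h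
  · exact mem_convexHull_of_orient hp hq hr h1 (hX _ _ f2).le h (hX _ _ f1).le
  · have h' : 0 ≤ orient p r X := by rw [orient_swap]; linarith
    exact mem_convexHull_of_orient hr hs hp h3 (hX _ _ f4).le h' (hX _ _ f3).le

/-- If no two of the sets meet in the hull of `P`, then `2 n + 3 ≤ 3 k`. -/
lemma ConvexPosition.two_mul_card_add_three_le {P : Finset Plane} (hP : ConvexPosition P) {k : ℕ}
    {K : Fin k → Set Plane} (hK : ∀ i, Convex ℝ (K i)) (hE : Encapsulates K P)
    (hne : P.Nonempty)
    (hdisj : ∀ i j, i ≠ j → ∀ X ∈ convexHull ℝ (P : Set Plane), X ∈ K i → X ∉ K j) :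
    2 * P.card + 3 ≤ 3 * k := by
  classical
  obtain ⟨f, hf, hpos⟩ := hP.exists_enum
  have hmem : ∀ p ∈ Finset.range P.card, f p ∈ P := fun p hp => hf.mem p (Finset.mem_range.1 hp)
  have hPK : ∀ i, ∀ p ∈ P, p ∉ K i := fun i p hp => (hE p hp).notMem i
  have hex : ∀ p ∈ P, ∀ u : Plane, u ≠ 0 → ∃ i, Germ (K i) p u := fun p hp u hu =>
    (hE p hp).exists_germ hK hu
  obtain ⟨u₀, hu₀⟩ : ∃ u : Plane, u ≠ 0 := exists_ne 0
  obtain ⟨p₀, hp₀⟩ := hne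
  have : Nonempty (Fin k) := ⟨(hex p₀ hp₀ u₀ hu₀).choose⟩
  have hnc : NonCrossing (Finset.range P.card) (fun p i => ∃ u, Germ (K i) (f p) u) := by
    rintro a ha b hb c hc d hd hab hbc hcd i j ⟨u, hu⟩ ⟨v, hv⟩ ⟨w, hw⟩ ⟨z, hz⟩
    by_contra hij
    have hd' := Finset.mem_range.1 hd
    obtain ⟨X, h1, h2, h3⟩ := exists_mem_convexHull_of_germs (hK i) (hK j) (S := (P : Set Plane))
      (hmem a ha) (hmem b hb) (hmem c hc) (hmem d hd) (hpos a b c hab hbc (by omega))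
      (hpos b c d hbc hcd hd') (by rw [orient_rot]; exact hpos a c d (by omega) hcd hd')
      (by rw [← orient_rot]; exact hpos a b d hab (by omega) hd') hu hv hw hz
    exact hdisj i j hij X h3 h1 h2
  obtain ⟨l, r, hd, hlr⟩ := hnc.exists_distinctPairs (by
    intro p hp
    obtain ⟨i, hi⟩ := hex _ (hmem p hp) u₀ hu₀
    obtain ⟨j, hj⟩ := hex _ (hmem p hp) (-u₀) (neg_ne_zero.2 hu₀)
    refine ⟨i, j, ?_, ⟨_, hi⟩, ⟨_, hj⟩⟩
    rintro rfl
    exact hPK i _ (hmem p hp) (hi.mem_of_neg (hK i) hj)) (by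
    intro p hp q hq hpq u w _ _ _ _ _
    have hne : f p ≠ f q := hf.ne p q (Finset.mem_range.1 hp) (Finset.mem_range.1 hq) hpq
    -- On the line through the two points, the outward germ at `f p`, the outward germ at `f q` and
    -- the inward germ at `f p` belong to three different sets, so two colours are not enough.
    obtain ⟨a, ha⟩ := hex _ (hmem p hp) (f p - f q) (sub_ne_zero.2 hne)
    obtain ⟨b, hb⟩ := hex _ (hmem q hq) (f q - f p) (sub_ne_zero.2 hne.symm)
    obtain ⟨c, hc⟩ := hex _ (hmem p hp) (f q - f p) (sub_ne_zero.2 hne.symm)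
    have hab : a ≠ b := by
      rintro rfl
      exact hPK a _ (hmem p hp) (ha.mem_of_outward (hK a) hb)
    have hac : a ≠ c := by
      rintro rfl
      exact hPK a _ (hmem p hp) (ha.mem_of_neg (hK a) (by rwa [neg_sub]))
    have hcb : c ≠ b := by
      rintro rfl
      exact hPK c _ (hmem q hq) (hc.mem_of_parallel (hK c) hb)
    by_contra! hcon
    have h1 : a = u ∨ a = w := by
      by_contra! h
      exact (hcon a h.1 h.2).1 _ ha
    have h2 : b = u ∨ b = w := by
      by_contra! h
      exact (hcon b h.1 h.2).2 _ hb
    have h3 : c = u ∨ c = w := by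
      by_contra! h
      exact (hcon c h.1 h.2).1 _ hc
    clear * - h1 h2 h3 hab hac hcb
    grind)
  have := card_le_of_nonCrossing P.card (Finset.range P.card) (Finset.card_range _)
    (Finset.univ : Finset (Fin k)) l r Finset.univ_nonempty (fun p _ => by simp) hd (by
      intro a ha b hb c hc d hd' hab hbc hcd i j h1 h2 h3 h4
      have key : ∀ p ∈ Finset.range P.card, ∀ i, (l p = i ∨ r p = i) →
          ∃ u, Germ (K i) (f p) u := by
        rintro p hp i (rfl | rfl)
        · exact (hlr p hp).1
        · exact (hlr p hp).2
      exact hnc a ha b hb c hc d hd' hab hbc hcd i j (key a ha i h1) (key c hc i h2)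
        (key b hb j h3) (key d hd' j h4))
  simpa using this

theorem ConvexPosition.disjointBound_le {P : Finset Plane} (hP : ConvexPosition P) {k : ℕ}
    {K : Fin k → Set Plane} (hK : ∀ i, Convex ℝ (K i)) (hE : Encapsulates K P)
    (hne : P.Nonempty) (hdisj : Pairwise fun i j => Disjoint (K i) (K j)) :
    disjointBound P.card ≤ k := by
  have := hP.two_mul_card_add_three_le hK hE hne
    (fun i j hij X _ h1 h2 => Set.disjoint_left.1 (hdisj hij) h1 h2)
  unfold disjointBound
  omega

/-- Rounding up, the two cases give `(n + 5) / 2` and `(2 n + 5) / 3`; for `n ≥ 1` the latter is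
smaller only at `n = 1` and `n = 3`. -/
theorem ConvexPosition.convexBound_le {P : Finset Plane} (hP : ConvexPosition P) {k : ℕ}
    {K : Fin k → Set Plane} (hK : ∀ i, Convex ℝ (K i)) (hE : Encapsulates K P)
    (hne : P.Nonempty) : convexBound P.card ≤ k := by
  have hpos := hne.card_pos
  have h : P.card + 4 ≤ 2 * k ∨ 2 * P.card + 3 ≤ 3 * k := by
    by_cases hd : ∀ i j, i ≠ j → ∀ X ∈ convexHull ℝ (P : Set Plane), X ∈ K i → X ∉ K j
    · exact Or.inr (hP.two_mul_card_add_three_le hK hE hne hd)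
    · push Not at hd
      obtain ⟨i, j, hij, X, hX, h1, h2⟩ := hd
      exact Or.inl (hP.card_add_four_le hK hE hij h1 h2 hX)
  unfold convexBound delta
  split_ifs with h0 <;> omega


/-! ### The four parameters and their extremal values -/

lemma RegionCov.cov_le {P : Finset Plane} {k : ℕ} (h : RegionCov False Set.univ P k) :
    cov P ≤ k := by
  obtain ⟨K, hK, -, hU⟩ := h
  exact iInf₂_le k ⟨K, hK, by rw [CoversCompl, hU, Set.compl_eq_univ_sdiff]⟩

lemma RegionCov.covDisj_le {P : Finset Plane} {k : ℕ} (h : RegionCov True Set.univ P k) :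
    covDisj P ≤ k := by
  obtain ⟨K, hK, hd, hU⟩ := h
  exact iInf₂_le k ⟨K, hK, hd trivial, by rw [CoversCompl, hU, Set.compl_eq_univ_sdiff]⟩

lemma CoversCompl.encapsulates {k : ℕ} {K : Fin k → Set Plane} {P : Finset Plane}
    (h : CoversCompl K P) : Encapsulates K P := by
  intro p hp
  refine ⟨((P : Set Plane) \ {p})ᶜ, ?_, ?_⟩
  · exact (P.finite_toSet.subset Set.sdiff_subset).isClosed.isOpen_compl.mem_nhds (by simp)
  · rw [CoversCompl] at h
    rw [h]
    ext z
    simp only [Set.mem_inter_iff, Set.mem_compl_iff, Finset.mem_coe, Set.mem_sdiff,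
      Set.mem_singleton_iff]
    constructor
    · rintro ⟨h1, h2⟩
      exact ⟨h2, fun e => h1 (e ▸ hp)⟩
    · rintro ⟨h1, h2⟩
      exact ⟨fun h => h1 ⟨h, h2⟩, h1⟩

lemma enc_le_cov (P : Finset Plane) : enc P ≤ cov P :=
  le_iInf₂ fun k ⟨K, hK, h⟩ => iInf₂_le k ⟨K, hK, h.encapsulates⟩

lemma encDisj_le_covDisj (P : Finset Plane) : encDisj P ≤ covDisj P :=
  le_iInf₂ fun k ⟨K, hK, hd, h⟩ => iInf₂_le k ⟨K, hK, hd, h.encapsulates⟩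

lemma CoversCompl.pos {k : ℕ} {K : Fin k → Set Plane} {P : Finset Plane}
    (h : CoversCompl K P) : 1 ≤ k := by
  obtain ⟨z, hz⟩ := P.finite_toSet.infinite_compl.nonempty
  rw [CoversCompl] at h
  rw [← h] at hz
  obtain ⟨i, -⟩ := Set.mem_iUnion.1 hz
  exact i.pos

lemma ConvexPosition.convexBound_le_enc {P : Finset Plane} (hP : ConvexPosition P)
    (hne : P.Nonempty) : (convexBound P.card : ℕ∞) ≤ enc P :=
  le_iInf₂ fun _ ⟨_, hK, h⟩ => Nat.cast_le.2 (hP.convexBound_le hK h hne)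

lemma ConvexPosition.disjointBound_le_encDisj {P : Finset Plane} (hP : ConvexPosition P)
    (hne : P.Nonempty) : (disjointBound P.card : ℕ∞) ≤ encDisj P :=
  le_iInf₂ fun _ ⟨_, hK, hd, h⟩ => Nat.cast_le.2 (hP.disjointBound_le hK h hne hd)

/-- For `P = ∅` encapsulation is vacuous and gives nothing, but a cover of the plane still needs one
set, and `convexBound 0 = 1`. -/
lemma ConvexPosition.convexBound_le_cov {P : Finset Plane} (hP : ConvexPosition P) :
    (convexBound P.card : ℕ∞) ≤ cov P := by
  rcases P.eq_empty_or_nonempty with rfl | hne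
  · exact le_iInf₂ fun _ ⟨_, _, h⟩ => Nat.cast_le.2 h.pos
  · exact (hP.convexBound_le_enc hne).trans (enc_le_cov P)

lemma ConvexPosition.disjointBound_le_covDisj {P : Finset Plane} (hP : ConvexPosition P) :
    (disjointBound P.card : ℕ∞) ≤ covDisj P := by
  rcases P.eq_empty_or_nonempty with rfl | hne
  · exact le_iInf₂ fun _ ⟨_, _, _, h⟩ => Nat.cast_le.2 h.pos
  · exact (hP.disjointBound_le_encDisj hne).trans (encDisj_le_covDisj P)

/-- There are `n` points in convex position, namely on a parabola. -/
lemma exists_convexPosition (n : ℕ) : ∃ P : Finset Plane, ConvexPosition P ∧ P.card = n := by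
  classical
  let g : ℕ → Plane := fun i => !₂[(i : ℝ), (i : ℝ) ^ 2]
  have hg : Function.Injective g := by
    intro i j h
    have : g i 0 = g j 0 := by rw [h]
    simpa [g] using this
  refine ⟨(Finset.range n).image g, ?_, by
    rw [Finset.card_image_of_injective _ hg, Finset.card_range]⟩
  refine (convexIndependent_set_iff_notMem_convexHull_sdiff
    (s := (((Finset.range n).image g : Finset Plane) : Set Plane))).2 fun x hx hmem => ?_
  obtain ⟨i, -, rfl⟩ := Finset.mem_image.1 hx
  -- The open half-plane above the tangent at `g i`; at `g j` the expression equals `(j - i) ^ 2`.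
  have hconv : Convex ℝ {z : Plane | 0 < z 1 - 2 * i * z 0 + (i : ℝ) ^ 2} :=
    convex_of_affine_lt (g := fun z : Plane => z 1 - 2 * i * z 0 + (i : ℝ) ^ 2) (by
      intro x y s t hst
      simp only [PiLp.add_apply, PiLp.smul_apply, smul_eq_mul]
      linear_combination (-(i : ℝ) ^ 2) * hst) 0
  have : g i ∈ {z : Plane | 0 < z 1 - 2 * i * z 0 + (i : ℝ) ^ 2} := by
    refine convexHull_min ?_ hconv hmem
    rintro z ⟨hz, hzi⟩
    obtain ⟨j, -, rfl⟩ := Finset.mem_image.1 hz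
    have hij : (j : ℝ) - i ≠ 0 := by
      rw [sub_ne_zero, Nat.cast_injective.ne_iff]
      rintro rfl
      exact hzi rfl
    have : 0 < ((j : ℝ) - i) ^ 2 := by positivity
    simp only [Set.mem_ofPred_eq, g]
    simp
    linarith
  simp [g] at this
  linarith

lemma toENNReal_le_of_le_div {m : ℕ∞} {n : ℕ} (h : m ≤ ((7 * n + 44) / 11 : ℕ)) :
    (m : ℝ≥0∞) ≤ 7 * (n : ℝ≥0∞) / 11 + 4 := by
  refine (ENat.toENNReal_le.2 h).trans ?_
  rw [ENat.toENNReal_coe]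
  have h4 : (4 : ℝ≥0∞) = 44 / 11 := by
    rw [ENNReal.eq_div_iff (by norm_num) (by norm_num)]; norm_num
  rw [h4, ← ENNReal.add_div, ENNReal.le_div_iff_mul_le (by simp) (by simp)]
  exact_mod_cast Nat.div_mul_le_self (7 * n + 44) 11

theorem theorem1 (n : ℕ) :
    -- points in convex position
    (∀ P : Finset Plane, ConvexPosition P → P.card = n →
      (cov P = convexBound n ∧ covDisj P = disjointBound n) ∧
      (1 ≤ n → enc P = convexBound n ∧ encDisj P = disjointBound n)) ∧
    (maxConvex cov n = convexBound n ∧ maxConvex covDisj n = disjointBound n) ∧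
    (1 ≤ n → maxConvex enc n = convexBound n ∧ maxConvex encDisj n = disjointBound n) ∧
    -- points in general position
    (∀ P : Finset Plane, GeneralPosition P → P.card = n →
      (enc P : ℝ≥0∞) ≤ 7 * (n : ℝ≥0∞) / 11 + 4 ∧
      (cov P : ℝ≥0∞) ≤ 7 * (n : ℝ≥0∞) / 11 + 4 ∧
      encDisj P ≤ disjointBound n ∧
      covDisj P ≤ disjointBound n) ∧
    ((maxGeneral enc n : ℝ≥0∞) ≤ 7 * (n : ℝ≥0∞) / 11 + 4 ∧
      (maxGeneral cov n : ℝ≥0∞) ≤ 7 * (n : ℝ≥0∞) / 11 + 4) ∧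
    (convexBound n ≤ maxGeneral cov n ∧ maxGeneral covDisj n = disjointBound n) ∧
    (1 ≤ n → convexBound n ≤ maxGeneral enc n ∧ maxGeneral encDisj n = disjointBound n) := by
  have hconv : ∀ P : Finset Plane, ConvexPosition P → P.card = n →
      (cov P = convexBound n ∧ covDisj P = disjointBound n) ∧
      (1 ≤ n → enc P = convexBound n ∧ encDisj P = disjointBound n) := by
    rintro P hP rfl
    have h1 : cov P ≤ convexBound P.card := hP.regionCov_convexBound.cov_le
    have h2 : covDisj P ≤ disjointBound P.card :=
      (hP.generalPosition.regionCov_disjointBound True).covDisj_le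
    refine ⟨⟨h1.antisymm hP.convexBound_le_cov, h2.antisymm hP.disjointBound_le_covDisj⟩,
      fun hn => ?_⟩
    have hne : P.Nonempty := Finset.card_pos.1 hn
    exact ⟨((enc_le_cov P).trans h1).antisymm (hP.convexBound_le_enc hne),
      ((encDisj_le_covDisj P).trans h2).antisymm (hP.disjointBound_le_encDisj hne)⟩
  have hgen : ∀ P : Finset Plane, GeneralPosition P → P.card = n →
      cov P ≤ ((7 * n + 44) / 11 : ℕ) ∧ covDisj P ≤ disjointBound n := by
    rintro P hP rfl
    exact ⟨hP.regionCov_sevenElevenths.cov_le, (hP.regionCov_disjointBound True).covDisj_le⟩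
  obtain ⟨Q, hQ, hQn⟩ := exists_convexPosition n
  have hmaxConvex : ∀ (f : Finset Plane → ℕ∞) (b : ℕ∞),
      (∀ P, ConvexPosition P → P.card = n → f P = b) → maxConvex f n = b := fun f b h =>
    le_antisymm (iSup₂_le fun P hP => (h P hP.1 hP.2).le)
      ((h Q hQ hQn).ge.trans (le_iSup₂_of_le Q ⟨hQ, hQn⟩ le_rfl))
  have hle : ∀ (f : Finset Plane → ℕ∞) (b : ℕ∞),
      (∀ P, GeneralPosition P → P.card = n → f P ≤ b) → maxGeneral f n ≤ b := fun f b h =>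
    iSup₂_le fun P hP => h P hP.1 hP.2
  have hge : ∀ f : Finset Plane → ℕ∞, f Q ≤ maxGeneral f n := fun f =>
    le_iSup₂_of_le Q ⟨hQ.generalPosition, hQn⟩ le_rfl
  obtain ⟨⟨hQ1, hQ2⟩, hQ3⟩ := hconv Q hQ hQn
  refine ⟨hconv, ⟨hmaxConvex _ _ fun P hP hPn => (hconv P hP hPn).1.1,
      hmaxConvex _ _ fun P hP hPn => (hconv P hP hPn).1.2⟩,
    fun hn => ⟨hmaxConvex _ _ fun P hP hPn => ((hconv P hP hPn).2 hn).1,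
      hmaxConvex _ _ fun P hP hPn => ((hconv P hP hPn).2 hn).2⟩,
    fun P hP hPn => ?_, ⟨?_, ?_⟩, ⟨?_, ?_⟩, fun hn => ⟨?_, ?_⟩⟩
  · obtain ⟨h1, h2⟩ := hgen P hP hPn
    exact ⟨toENNReal_le_of_le_div ((enc_le_cov P).trans h1), toENNReal_le_of_le_div h1,
      (encDisj_le_covDisj P).trans h2, h2⟩
  · exact toENNReal_le_of_le_div
      (hle _ _ fun P hP hPn => (enc_le_cov P).trans (hgen P hP hPn).1)
  · exact toENNReal_le_of_le_div (hle _ _ fun P hP hPn => (hgen P hP hPn).1)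
  · exact hQ1 ▸ hge cov
  · exact (hle _ _ fun P hP hPn => (hgen P hP hPn).2).antisymm (hQ2 ▸ hge covDisj)
  · exact (hQ3 hn).1 ▸ hge enc
  · exact (hle _ _ fun P hP hPn => (encDisj_le_covDisj P).trans (hgen P hP hPn).2).antisymm
      ((hQ3 hn).2 ▸ hge encDisj)
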